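/- Let $F$ be an algebraically closed field of characteristic zero, $G$ a finite abelian group with dual group $\widehat{G}=\mathrm{Hom}(G,F^{*})$, $n\ge 1$, $R=M_n(F)$ and $L=\mathrm{sl}(n)\subset R$ the Lie algebra of matrices of trace zero. Let $L=\bigoplus_{g\in G}L_g$ be a $G$-grading of the Lie algebra $L$, that is, $[L_g,L_h]\subset L_{gh}$ for all $g,h\in G$. Suppose that the grading is inner: for each $\chi\in\widehat{G}$ there is a nondegenerate matrix $T_\chi\in M_n(F)$ such that $\sum_{g\in G}\chi(g)X_g=T_\chi^{-1}XT_\chi$ for every $X=\sum_{g\in G} X_g\in L$ with $X_g\in L_g$. Then there is a $G$-grading $R=\bigoplus_{g\in G}R_g$ of the associative algebra $R$ (so $R_gR_h\subset R_{gh}$) such that $L_g=R_g\cap L$ for every $g\in G$ and such that, as a $G$-graded algebra, $R$ is isomorphic to a tensor product $$R^{(0)}\otimes R^{(1)}\otimes\cdots\otimes R^{(k)},\qquad k\ge 0,$$ graded so that the degree of a tensor of homogeneous elements is the product of their degrees, where: (1) $R^{(0)}=M_{n_0}(F)$, $n_0\ge 1$, has an elementary $G$-grading, i.e. there is a tuple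 $(g_1,\ldots,g_{n_0})\in G^{n_0}$ such that each matrix unit $E_{ij}$ is homogeneous of degree $g_i^{-1}g_j$; let $S=\{g\in G: R^{(0)}_g\neq 0\}$ be its support. (2) For $i=1,\ldots,k$, $R^{(i)}=M_{n_i}(F)$, $n_i\ge 1$, has an $\varepsilon_i$-grading, where $\varepsilon_i\in F$ is a primitive $n_i$-th root of $1$, with support a subgroup $H_i\cong\mathbb{Z}_{n_i}\times\mathbb{Z}_{n_i}$ of $G$. That is, $H_i=\langle a_i\rangle\times\langle b_i\rangle$ with $a_i,b_i$ of order $n_i$, and for $g=a_i^pb_i^q\in H_i$ the component of degree $g$ is the line spanned by $X_{a_i}^pX_{b_i}^q$, where $X_{a_i}=\mathrm{diag}(\varepsilon_i^{n_i-1},\varepsilon_i^{n_i-2},\ldots,1)$ and $X_{b_i}=E_{12}+E_{23}+\cdots+E_{n_i-1,n_i}+E_{n_i,1}$ (with $X_{b_i}=I$ if $n_i=1$); the components of degree outside $H_i$ are zero. (3) The product $H=H_1\cdots H_k$ is direct, $H\cong H_1\times\cdots\times H_k$, and $S\cap H=\{e\}$, where $e$ is the identity of $G$. -/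

import Mathlib

open scoped TensorProduct

attribute [local instance] LieRing.ofAssociativeRing

namespace GroupGrading

section General

variable {F : Type*} [Field F] {G : Type*}

open Classical in
/-- A `G`-grading of an associative `F`-algebra `A` by the group `G`:
`A = ⨁ g, 𝓐 g` and `𝓐 g * 𝓐 h ⊆ 𝓐 (g * h)`. -/
structure IsAlgGrading [Group G] {A : Type*} [Ring A] [Algebra F A]
    (𝓐 : G → Submodule F A) : Prop where
  isInternal : DirectSum.IsInternal 𝓐
  mul_mem : ∀ (g h : G) (x y : A), x ∈ 𝓐 g → y ∈ 𝓐 h → x * y ∈ 𝓐 (g * h)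

open Classical in
/-- A `G`-grading of a Lie algebra `L` over `F` by the group `G`:
`L = ⨁ g, 𝓛 g` and `[𝓛 g, 𝓛 h] ⊆ 𝓛 (g * h)`. -/
structure IsLieGrading [Group G] {L : Type*} [LieRing L] [LieAlgebra F L]
    (𝓛 : G → Submodule F L) : Prop where
  isInternal : DirectSum.IsInternal 𝓛
  lie_mem : ∀ (g h : G) (x y : L), x ∈ 𝓛 g → y ∈ 𝓛 h → ⁅x, y⁆ ∈ 𝓛 (g * h)

/-- The support `{g | 𝓥 g ≠ 0}` of a family of subspaces. -/
def support {V : Type*} [AddCommGroup V] [Module F V] (𝓥 : G → Submodule F V) : Set G :=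
  {g | 𝓥 g ≠ ⊥}

open Classical in
/-- The action of a character `χ : G → Fˣ` on a vector space `V = ⨁ g, 𝓥 g`:
it sends `∑ g, v_g` with `v_g ∈ 𝓥 g` to `∑ g, χ g • v_g`. -/
noncomputable def charAction [Group G] {V : Type*} [AddCommGroup V] [Module F V]
    (𝓥 : G → Submodule F V) (h : DirectSum.IsInternal 𝓥) (χ : G →* Fˣ) : V →ₗ[F] V :=
  (DirectSum.toModule F G V fun g => (χ g : F) • (𝓥 g).subtype) ∘ₗ
    (LinearEquiv.ofBijective (DirectSum.coeLinearMap 𝓥) h).symm.toLinearMap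

open Classical in
theorem charAction_apply_of_mem [Group G] {V : Type*} [AddCommGroup V] [Module F V]
    (𝓥 : G → Submodule F V) (h : DirectSum.IsInternal 𝓥) (χ : G →* Fˣ) {g : G} {v : V}
    (hv : v ∈ 𝓥 g) : charAction 𝓥 h χ v = (χ g : F) • v := by
  have e : (LinearEquiv.ofBijective (DirectSum.coeLinearMap 𝓥) h).symm v
      = DirectSum.lof F G (fun g => 𝓥 g) g ⟨v, hv⟩ := by
    rw [LinearEquiv.symm_apply_eq]
    exact (DirectSum.coeLinearMap_lof 𝓥 g ⟨v, hv⟩).symm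
  simp only [charAction, LinearMap.comp_apply, LinearEquiv.coe_coe, e, DirectSum.toModule_lof]
  rfl

/-- The tensor product grading of `A ⊗ (⨂ i, B i)`: the component of degree `g` is spanned by the
tensors `a ⊗ (⨂ i, b i)` of homogeneous elements whose degrees have the product `g`. -/
def tensorGrading [CommGroup G] {ι : Type*} [Fintype ι]
    {A : Type*} [AddCommGroup A] [Module F A]
    {B : ι → Type*} [∀ i, AddCommGroup (B i)] [∀ i, Module F (B i)]
    (𝓐 : G → Submodule F A) (𝓑 : ∀ i, G → Submodule F (B i)) (g : G) :
    Submodule F (A ⊗[F] (PiTensorProduct F B)) :=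
  Submodule.span F
    {x | ∃ (d₀ : G) (d : ι → G) (a : A) (b : ∀ i, B i),
      a ∈ 𝓐 d₀ ∧ (∀ i, b i ∈ 𝓑 i (d i)) ∧ d₀ * ∏ i, d i = g ∧
      x = a ⊗ₜ[F] PiTensorProduct.tprod F b}

end General

section MatrixGradings

variable {F : Type*} [Field F] {G : Type*} [CommGroup G]

/-- The elementary grading of `M_n(F)` given by the `n`-tuple `t`: the matrix unit `E_{ij}` has
degree `(t i)⁻¹ * t j`. -/
def elementaryGrading (F : Type*) [Field F] {n : ℕ} (t : Fin n → G) (g : G) :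
    Submodule F (Matrix (Fin n) (Fin n) F) :=
  Submodule.span F {M | ∃ i j : Fin n, (t i)⁻¹ * t j = g ∧ M = Matrix.single i j 1}

/-- The diagonal matrix `X_a = diag(ε^(m-1), ε^(m-2), …, ε, 1)`. -/
def matXa (m : ℕ) (ε : F) : Matrix (Fin m) (Fin m) F :=
  Matrix.diagonal fun i => ε ^ (m - 1 - (i : ℕ))

/-- The cyclic permutation matrix `X_b`, with entries `1` just above the diagonal and in the lower
left corner. -/
def matXb (F : Type*) [Field F] (m : ℕ) : Matrix (Fin m) (Fin m) F :=
  Matrix.of fun i j => if (j : ℕ) = ((i : ℕ) + 1) % m then 1 else 0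

/-- The `ε`-grading of `M_m(F)`, where the grading group `ℤ/m × ℤ/m` is identified with the
subgroup `H` of `G` through `θ`: the element `X_a ^ i * X_b ^ j` has degree `θ (i, j)`. -/
def epsilonGrading {m : ℕ} (ε : F) {H : Subgroup G}
    (θ : Multiplicative (ZMod m × ZMod m) ≃* H) (g : G) :
    Submodule F (Matrix (Fin m) (Fin m) F) :=
  Submodule.span F {M | ∃ i j : ℕ,
    ((θ (Multiplicative.ofAdd ((i : ZMod m), (j : ZMod m))) : H) : G) = g ∧
    M = matXa m ε ^ i * matXb F m ^ j}

/-- The `G`-graded algebra `(M_n(F), 𝓡)` is isomorphic to a tensor product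
`R⁽⁰⁾ ⊗ R⁽¹⁾ ⊗ ⋯ ⊗ R⁽ᵏ⁾`, where `R⁽⁰⁾` is a matrix algebra with an elementary `G`-grading of
support `S`, each `R⁽ⁱ⁾ = M_{m_i}(F)`, `i = 1, …, k`, has an `ε_i`-grading with `ε_i` a primitive
root of `1` of degree `m_i` and with support a subgroup `H_i ≅ ℤ/m_i × ℤ/m_i` of `G`, the product
`H = H_1 ⋯ H_k` is direct, and `S ∩ H = {1}`. -/
def HasTensorForm {n : ℕ} (𝓡 : G → Submodule F (Matrix (Fin n) (Fin n) F)) : Prop :=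
  ∃ (n₀ k : ℕ) (m : Fin k → ℕ) (t : Fin n₀ → G) (ε : Fin k → F) (H : Fin k → Subgroup G)
    (θ : ∀ i, Multiplicative (ZMod (m i) × ZMod (m i)) ≃* H i),
    0 < n₀ ∧ (∀ i, 0 < m i) ∧ (∀ i, IsPrimitiveRoot (ε i) (m i)) ∧
    (∀ i, support (epsilonGrading (ε i) (θ i)) = (H i : Set G)) ∧
    Function.Injective (fun h : (∀ i, H i) => ∏ i, (h i : G)) ∧
    support (elementaryGrading F t) ∩ ((⨆ i, H i : Subgroup G) : Set G) = {1} ∧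
    ∃ e : Matrix (Fin n) (Fin n) F ≃ₐ[F]
        Matrix (Fin n₀) (Fin n₀) F ⊗[F]
          (PiTensorProduct F fun i : Fin k => Matrix (Fin (m i)) (Fin (m i)) F),
      ∀ g : G, (𝓡 g).map e.toLinearMap =
        tensorGrading (elementaryGrading F t) (fun i => epsilonGrading (ε i) (θ i)) g

/-- A `G`-grading of `sl(n)` is inner if every character of `G` acts on `sl(n)` as
`X ↦ T⁻¹ * X * T` for some nondegenerate matrix `T`. -/
def IsInnerGrading {n : ℕ}
    (𝓛 : G → Submodule F (LieAlgebra.SpecialLinear.sl (Fin n) F)) (h : IsLieGrading 𝓛) : Prop :=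
  ∀ χ : G →* Fˣ, ∃ T : GL (Fin n) F, ∀ X : LieAlgebra.SpecialLinear.sl (Fin n) F,
    (charAction 𝓛 h.isInternal χ X : Matrix (Fin n) (Fin n) F) =
      (↑T⁻¹ : Matrix (Fin n) (Fin n) F) * (X : Matrix (Fin n) (Fin n) F)
        * (↑T : Matrix (Fin n) (Fin n) F)

end MatrixGradings

end GroupGrading

namespace GroupGrading

/-! ### Independent spanning families of subspaces -/

section Decomposition

variable {F : Type*} [Field F] {G : Type*} {V : Type*} [AddCommGroup V] [Module F V]

/-! Let `R_g` be the common eigenspace on which conjugation by every `T χ` is multiplication by `χ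
g`. Conjugation is multiplicative, so `R_g R_h ⊆ R_{gh}`; characters separate the points of `G`, so
`R_g ∩ L = L_g`. As `R = F·1 ⊕ L` with `1` in degree `1`, these eigenspaces grade `R`, and
conjugation invariance of the trace kills traces outside degree `1`.

The rest is a graded Wedderburn argument. Write `1` as a sum of orthogonal primitive idempotents of
degree `1`. The trace form is nondegenerate and pairs degree `g` only with degree `g⁻¹`, so nonzero
homogeneous elements between two such idempotents are invertible (`MemCorner.exists_inverse`). Hence
one corner `eRe` is a graded division algebra with support a subgroup `H`, its homogeneous
components being lines because `F` is algebraically closed. The invertible elements linking `e` to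
the other idempotents give matrix units, so `R` is a matrix algebra with elementary grading times a
commuting twisted group algebra of `H`. Choosing the degrees of the links among fixed
representatives of `G/H` forces the support of the elementary factor to meet `H` only in `1`.

Commutation in the twisted group algebra defines an alternating bicharacter on `H`, nondegenerate
because the centre of `R` is `F`. A symplectic decomposition of `H` into orthogonal hyperbolic pairs
(`exists_symplectic_generators`) yields commuting pairs of elements which, after rescaling, satisfy
the clock and shift relations; each pair generates a matrix algebra with an `ε`-grading. The
multiplication map from the tensor product is graded and surjective, and is injective by a dimension
count. -/

theorem exists_sum_eq_of_iSup_eq_top [Fintype G] {𝓥 : G → Submodule F V} (h : ⨆ g, 𝓥 g = ⊤)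
    (v : V) : ∃ x : G → V, (∀ g, x g ∈ 𝓥 g) ∧ ∑ g, x g = v := by
  have hv : v ∈ ⨆ g, 𝓥 g := h ▸ Submodule.mem_top
  obtain ⟨f, hf⟩ := (Submodule.mem_iSup_iff_exists_finsupp 𝓥 v).1 hv
  refine ⟨f, hf.1, ?_⟩
  rw [← hf.2, Finsupp.sum_fintype _ _ (fun _ => rfl)]

theorem eq_zero_of_sum_eq_zero [Fintype G] {𝓥 : G → Submodule F V} (h : iSupIndep 𝓥)
    {x : G → V} (hx : ∀ g, x g ∈ 𝓥 g) (h0 : ∑ g, x g = 0) (g : G) : x g = 0 :=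
  (iSupIndep_iff_finsetSum_eq_zero_imp_eq_zero 𝓥).1 h Finset.univ x (fun g _ => hx g) h0 g
    (Finset.mem_univ g)

theorem iSupIndep_of_forall_sum_eq_zero [Fintype G] {𝓥 : G → Submodule F V}
    (h : ∀ x : G → V, (∀ g, x g ∈ 𝓥 g) → ∑ g, x g = 0 → ∀ g, x g = 0) : iSupIndep 𝓥 := by
  classical
  rw [iSupIndep_iff_finsetSum_eq_zero_imp_eq_zero]
  intro s v hv h0 g hg
  have := h (fun g => if g ∈ s then v g else 0) (fun g => by
    by_cases hg : g ∈ s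
    · simpa [hg] using hv g hg
    · simp [hg]) (by simpa [Finset.sum_ite_mem] using h0) g
  simpa [hg] using this

/-- A family of subspaces contained in an independent family is equal to it as soon as it
spans. -/
theorem eq_of_le_of_iSup_eq_top [Finite G] {𝓤 𝓥 : G → Submodule F V} (hle : ∀ g, 𝓤 g ≤ 𝓥 g)
    (hind : iSupIndep 𝓥) (htop : ⨆ g, 𝓤 g = ⊤) (g : G) : 𝓤 g = 𝓥 g := by
  classical
  have := Fintype.ofFinite G
  refine le_antisymm (hle g) fun v hv => ?_
  obtain ⟨x, hx, hsum⟩ := exists_sum_eq_of_iSup_eq_top htop v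
  have key := eq_zero_of_sum_eq_zero hind (x := fun g' => x g' - (if g' = g then v else 0))
    (fun g' => sub_mem (hle _ (hx g')) (by
      by_cases h : g' = g
      · subst h; simpa using hv
      · simp [h]))
    (by rw [Finset.sum_sub_distrib, hsum, Finset.sum_ite_eq']; simp) g
  rw [if_pos rfl, sub_eq_zero] at key
  exact key ▸ hx g

end Decomposition

/-- An algebraically closed field of characteristic zero has all roots of unity of order the
exponent of `G`, so characters separate points. -/
theorem exists_character_apply_ne {F : Type*} [Field F] [IsAlgClosed F] [CharZero F]
    {G : Type*} [CommGroup G] [Finite G] {g h : G} (hgh : g ≠ h) :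
    ∃ χ : G →* Fˣ, χ g ≠ χ h := by
  have : NeZero (Monoid.exponent G) := ⟨Monoid.exponent_ne_zero_of_finite⟩
  have : NeZero ((Monoid.exponent G : ℕ) : F) := ⟨by exact_mod_cast NeZero.ne _⟩
  obtain ⟨χ, hχ⟩ := CommGroup.exists_apply_ne_one_of_hasEnoughRootsOfUnity G F
    (a := g / h) (by rwa [Ne, div_eq_one])
  exact ⟨χ, by rwa [map_div, Ne, div_eq_one] at hχ⟩

/-! ### From an inner grading of `sl(n)` to a grading of the matrix algebra -/

section Inner

variable {F : Type*} [Field F] {G : Type*} [CommGroup G] {n : ℕ}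

/-- The subspace on which conjugation by each `T χ` acts as multiplication by `χ g`. -/
def conjEigenspace (T : (G →* Fˣ) → GL (Fin n) F) (g : G) :
    Submodule F (Matrix (Fin n) (Fin n) F) where
  carrier := {X | ∀ χ, (↑(T χ)⁻¹ : Matrix (Fin n) (Fin n) F) * X * (T χ).1 = (χ g : F) • X}
  add_mem' {X Y} hX hY χ := by rw [mul_add, add_mul, hX χ, hY χ, smul_add]
  zero_mem' χ := by simp
  smul_mem' c X hX χ := by rw [mul_smul_comm, smul_mul_assoc, hX χ, smul_comm]

variable {T : (G →* Fˣ) → GL (Fin n) F}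

theorem one_mem_conjEigenspace : (1 : Matrix (Fin n) (Fin n) F) ∈ conjEigenspace T 1 := by
  intro χ
  rw [mul_one, Units.inv_mul]
  simp

theorem mul_mem_conjEigenspace {g h : G} {X Y : Matrix (Fin n) (Fin n) F}
    (hX : X ∈ conjEigenspace T g) (hY : Y ∈ conjEigenspace T h) :
    X * Y ∈ conjEigenspace T (g * h) := by
  intro χ
  have : (↑(T χ)⁻¹ : Matrix (Fin n) (Fin n) F) * (X * Y) * (T χ).1 =
      ((↑(T χ)⁻¹ : Matrix (Fin n) (Fin n) F) * X * (T χ).1) *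
        ((↑(T χ)⁻¹ : Matrix (Fin n) (Fin n) F) * Y * (T χ).1) := by
    simp only [mul_assoc, Units.mul_inv_cancel_left]
  rw [this, hX χ, hY χ, smul_mul_smul_comm, map_mul, Units.val_mul]

variable [IsAlgClosed F] [CharZero F] [Finite G]

theorem trace_eq_zero_of_mem_conjEigenspace {g : G} (hg : g ≠ 1)
    {X : Matrix (Fin n) (Fin n) F} (hX : X ∈ conjEigenspace T g) : X.trace = 0 := by
  obtain ⟨χ, hχ⟩ := exists_character_apply_ne (F := F) hg
  have h := congrArg Matrix.trace (hX χ)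
  rw [Matrix.trace_mul_comm, ← mul_assoc, Units.mul_inv, one_mul, Matrix.trace_smul,
    smul_eq_mul] at h
  have h' : ((χ g : F) - 1) * X.trace = 0 := by rw [sub_mul, ← h, one_mul, sub_self]
  refine (mul_eq_zero.1 h').resolve_left fun h1 => hχ ?_
  rw [map_one]
  exact Units.ext (sub_eq_zero.1 h1)

/-- For the converse, split an eigenvector into its `𝓛`-components. Directness makes `χ h - χ g`
annihilate the component of degree `h`, and a character separating `h` from `g` forces it to vanish.
-/
theorem mem_iff_mem_conjEigenspace {𝓛 : G → Submodule F (LieAlgebra.SpecialLinear.sl (Fin n) F)}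
    (h𝓛 : IsLieGrading 𝓛)
    (hT : ∀ χ, ∀ X : LieAlgebra.SpecialLinear.sl (Fin n) F,
      (charAction 𝓛 h𝓛.isInternal χ X : Matrix (Fin n) (Fin n) F) =
        (↑(T χ)⁻¹ : Matrix (Fin n) (Fin n) F) * (X : Matrix (Fin n) (Fin n) F) * (T χ).1)
    (g : G) (X : LieAlgebra.SpecialLinear.sl (Fin n) F) :
    X ∈ 𝓛 g ↔ (X : Matrix (Fin n) (Fin n) F) ∈ conjEigenspace T g := by
  classical
  have := Fintype.ofFinite G
  constructor
  · intro hX χ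
    rw [← hT χ X, charAction_apply_of_mem 𝓛 h𝓛.isInternal χ hX]
    rfl
  · intro hX
    obtain ⟨x, hx, rfl⟩ := exists_sum_eq_of_iSup_eq_top h𝓛.isInternal.submodule_iSup_eq_top X
    have key : ∀ χ : G →* Fˣ, ∀ h, ((χ h : F) - (χ g : F)) • x h = 0 := fun χ =>
      eq_zero_of_sum_eq_zero h𝓛.isInternal.submodule_iSupIndep
        (fun h => (𝓛 h).smul_mem _ (hx h)) (by
          have h1 : charAction 𝓛 h𝓛.isInternal χ (∑ h, x h) = (χ g : F) • ∑ h, x h := by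
            apply Subtype.ext
            rw [hT χ]
            exact hX χ
          rw [map_sum, Finset.smul_sum] at h1
          simp only [sub_smul, Finset.sum_sub_distrib]
          rw [← h1, sub_eq_zero]
          exact Finset.sum_congr rfl fun h _ =>
            (charAction_apply_of_mem 𝓛 h𝓛.isInternal χ (hx h)).symm)
    refine sum_mem fun h _ => ?_
    by_cases hh : h = g
    · exact hh ▸ hx h
    · obtain ⟨χ, hχ⟩ := exists_character_apply_ne (F := F) hh
      have : x h = 0 := (smul_eq_zero.1 (key χ h)).resolve_left fun h0 =>
        hχ (Units.ext (sub_eq_zero.1 h0))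
      rw [this]
      exact zero_mem _

/-- Since `n ≠ 0` in `F`, every matrix is a scalar plus a traceless matrix, and scalars lie in
degree `1`. Independence reduces to that of `𝓛` once all terms of a vanishing sum are known to be
traceless. -/
theorem isAlgGrading_conjEigenspace (hn : 0 < n)
    {𝓛 : G → Submodule F (LieAlgebra.SpecialLinear.sl (Fin n) F)} (h𝓛 : IsLieGrading 𝓛)
    (hT : ∀ χ, ∀ X : LieAlgebra.SpecialLinear.sl (Fin n) F,
      (charAction 𝓛 h𝓛.isInternal χ X : Matrix (Fin n) (Fin n) F) =
        (↑(T χ)⁻¹ : Matrix (Fin n) (Fin n) F) * (X : Matrix (Fin n) (Fin n) F) * (T χ).1) :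
    IsAlgGrading (conjEigenspace T) := by
  classical
  have := Fintype.ofFinite G
  have hmem := mem_iff_mem_conjEigenspace h𝓛 hT
  have hn' : (n : F) ≠ 0 := by exact_mod_cast hn.ne'
  have htr : ∀ X : Matrix (Fin n) (Fin n) F,
      (X - (X.trace / n) • (1 : Matrix (Fin n) (Fin n) F)).trace = 0 := fun X => by
    rw [Matrix.trace_sub, Matrix.trace_smul, Matrix.trace_one, Fintype.card_fin, smul_eq_mul,
      div_mul_cancel₀ _ hn', sub_self]
  refine ⟨?_, fun g h X Y hX hY => mul_mem_conjEigenspace hX hY⟩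
  rw [DirectSum.isInternal_submodule_iff_iSupIndep_and_iSup_eq_top]
  constructor
  · refine iSupIndep_of_forall_sum_eq_zero fun x hx h0 => ?_
    have htr0 : ∀ g, (x g).trace = 0 := by
      have h1 : ∀ g, g ≠ 1 → (x g).trace = 0 := fun g hg =>
        trace_eq_zero_of_mem_conjEigenspace hg (hx g)
      intro g
      by_cases hg : g = 1
      · subst hg
        -- The degree `1` term is traceless too, since the whole sum and all its other terms are.
        have h2 := congrArg Matrix.trace h0
        rw [Matrix.trace_sum, Finset.sum_eq_single 1 (fun g _ hg => h1 g hg) (by simp),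
          Matrix.trace_zero] at h2
        exact h2
      · exact h1 g hg
    let y : G → LieAlgebra.SpecialLinear.sl (Fin n) F := fun g =>
      ⟨x g, (htr0 g)⟩
    have hy := eq_zero_of_sum_eq_zero h𝓛.isInternal.submodule_iSupIndep (x := y)
      (fun g => (hmem g (y g)).2 (hx g)) (by
        apply Subtype.ext
        rw [AddSubmonoidClass.coe_finsetSum]
        exact h0)
    exact fun g => congrArg Subtype.val (hy g)
  · rw [eq_top_iff]
    intro X _
    let Y : LieAlgebra.SpecialLinear.sl (Fin n) F :=
      ⟨_, (htr X)⟩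
    obtain ⟨y, hy, hsum⟩ := exists_sum_eq_of_iSup_eq_top h𝓛.isInternal.submodule_iSup_eq_top Y
    have hX : X = (∑ g, (y g : Matrix (Fin n) (Fin n) F)) + (X.trace / n) • 1 := by
      rw [← AddSubmonoidClass.coe_finsetSum, hsum, sub_add_cancel]
    rw [hX]
    refine add_mem (sum_mem fun g _ => ?_) ?_
    · exact Submodule.mem_iSup_of_mem g ((hmem g (y g)).1 (hy g))
    · exact Submodule.mem_iSup_of_mem 1 (Submodule.smul_mem _ _ one_mem_conjEigenspace)

end Inner

end GroupGrading

namespace GroupGrading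

/-! ### Primitive idempotents of the degree `1` component -/

section PrimitiveIdempotents

variable {F : Type*} [Field F] {G : Type*} [CommGroup G] {n : ℕ}

/-- `x` belongs to the Peirce corner `e A f` and has degree `g`. -/
structure MemCorner {A : Type*} [Ring A] [Algebra F A] (𝓐 : G → Submodule F A) (e f : A) (g : G)
    (x : A) : Prop where
  mem : x ∈ 𝓐 g
  left : e * x = x
  right : x * f = x

/-- `e` is an idempotent of degree `1` which is not the sum of two nonzero orthogonal idempotents
of degree `1`. -/
structure IsPrimitiveIdempotent {A : Type*} [Ring A] [Algebra F A] (𝓐 : G → Submodule F A)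
    (e : A) : Prop where
  mem : e ∈ 𝓐 1
  idem : e * e = e
  ne_zero : e ≠ 0
  eq_zero_or_eq : ∀ f ∈ 𝓐 1, f * f = f → e * f = f → f * e = f → f = 0 ∨ f = e

section Ring

variable {A : Type*} [Ring A] [Algebra F A] {𝓐 : G → Submodule F A}

theorem IsAlgGrading.mul_mem_of_eq (h𝓐 : IsAlgGrading 𝓐) {g h k : G} {x y : A} (hx : x ∈ 𝓐 g)
    (hy : y ∈ 𝓐 h) (hk : g * h = k) : x * y ∈ 𝓐 k := hk ▸ h𝓐.mul_mem g h x y hx hy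

theorem IsAlgGrading.pow_mem (h𝓐 : IsAlgGrading 𝓐) (h1 : (1 : A) ∈ 𝓐 1) {g : G} {x : A}
    (hx : x ∈ 𝓐 g) (k : ℕ) : x ^ k ∈ 𝓐 (g ^ k) := by
  induction k with
  | zero => simpa using h1
  | succ k ih => rw [pow_succ, pow_succ]; exact h𝓐.mul_mem _ _ _ _ ih hx

theorem IsAlgGrading.aeval_mem (h𝓐 : IsAlgGrading 𝓐) (h1 : (1 : A) ∈ 𝓐 1) {x : A}
    (hx : x ∈ 𝓐 1) (p : Polynomial F) : Polynomial.aeval x p ∈ 𝓐 1 := by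
  rw [Polynomial.aeval_eq_sum_range]
  refine sum_mem fun i _ => Submodule.smul_mem _ _ ?_
  simpa using h𝓐.pow_mem h1 hx i

/-- A non-nilpotent element of degree `1` in the corner of a primitive idempotent is invertible
in that corner. -/
theorem IsPrimitiveIdempotent.exists_inverse_of_not_isNilpotent [FiniteDimensional F A]
    (h𝓐 : IsAlgGrading 𝓐) (h1 : (1 : A) ∈ 𝓐 1) {e a : A} (he : IsPrimitiveIdempotent 𝓐 e)
    (ha : MemCorner 𝓐 e e 1 a) (hnil : ¬ IsNilpotent a) :
    ∃ b, MemCorner 𝓐 e e 1 b ∧ a * b = e ∧ b * a = e := by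
  have hp0 : minpoly F a ≠ 0 := minpoly.ne_zero (Algebra.IsIntegral.isIntegral a)
  obtain ⟨q, hq, hndvd⟩ :=
    Polynomial.exists_eq_pow_rootMultiplicity_mul_and_not_dvd (minpoly F a) hp0 0
  set k := (minpoly F a).rootMultiplicity 0
  rw [Polynomial.C_0, sub_zero] at hq hndvd
  have hcop : IsCoprime (Polynomial.X ^ (k + 1)) q :=
    ((Polynomial.irreducible_X.coprime_iff_not_dvd).2 hndvd).pow_left
  -- Fitting decomposition: with `minpoly = X ^ k * q` and `u X ^ (k + 1) + v q = 1`, the element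
  -- `u(a) a ^ (k + 1)` is an idempotent of degree `1` in the corner. By primitivity it is `0`,
  -- giving `a ^ k = 0`, or `e`, giving an inverse.
  obtain ⟨u, v, huv⟩ := hcop
  have hkill : a ^ k * Polynomial.aeval a q = 0 := by
    have := minpoly.aeval F a
    rw [hq, map_mul, map_pow, Polynomial.aeval_X] at this
    exact this
  set w := Polynomial.aeval a (u * Polynomial.X ^ k) with hw
  set z := Polynomial.aeval a (v * q) with hz
  have hwa : w * a + z = 1 := by
    have := congrArg (Polynomial.aeval a) huv
    rw [map_add, map_one] at this
    rw [← this, hw, hz, pow_succ, ← mul_assoc, map_mul _ (u * _), Polynomial.aeval_X]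
  have hcomm : w * a = a * w := by
    rw [hw]
    have := congrArg (Polynomial.aeval a) (mul_comm (u * Polynomial.X ^ k) Polynomial.X)
    rwa [map_mul, map_mul _ Polynomial.X, Polynomial.aeval_X] at this
  have hzw : z * (w * a) = 0 := by
    have : z * (w * a) = Polynomial.aeval a (v * u * Polynomial.X) * (a ^ k *
        Polynomial.aeval a q) := by
      have h2 : (v * q) * ((u * Polynomial.X ^ k) * Polynomial.X) =
        (v * u * Polynomial.X) * (Polynomial.X ^ k * q) := by ring
      have := congrArg (Polynomial.aeval a) h2
      rw [map_mul, map_mul _ (u * _), map_mul _ (v * u * _), map_mul _ (_ ^ k), map_pow,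
        Polynomial.aeval_X] at this
      exact this
    rw [this, hkill, mul_zero]
  have hidem : (w * a) * (w * a) = w * a := by
    calc (w * a) * (w * a) = (1 - z) * (w * a) := by rw [← hwa, add_sub_cancel_right]
      _ = w * a := by rw [sub_mul, hzw, one_mul, sub_zero]
  have hmem : w * a ∈ 𝓐 1 := h𝓐.mul_mem_of_eq (h𝓐.aeval_mem h1 ha.mem _) ha.mem (mul_one 1)
  have hf : w * a = e := by
    refine (he.eq_zero_or_eq _ hmem hidem ?_ ?_).resolve_left fun h0 => hnil ⟨k, ?_⟩
    · rw [hcomm, ← mul_assoc, ha.left]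
    · rw [mul_assoc, ha.right]
    · rw [h0, zero_add] at hwa
      calc a ^ k = z * a ^ k := by rw [hwa, one_mul]
        _ = Polynomial.aeval a v * (a ^ k * Polynomial.aeval a q) := by
          have h2 : (v * q) * Polynomial.X ^ k = v * (Polynomial.X ^ k * q) := by ring
          have := congrArg (Polynomial.aeval a) h2
          rwa [map_mul _ (v * q), map_mul _ v (_ * _), map_mul _ (_ ^ k), map_pow,
            Polynomial.aeval_X] at this
        _ = 0 := by rw [hkill, mul_zero]
  -- Compression by `e` is needed because for `k = 0` the polynomial defining `w` may have a
  -- constant term, and then `w` need not lie in the corner.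
  refine ⟨e * w * e, ⟨?_, ?_, ?_⟩, ?_, ?_⟩
  · exact h𝓐.mul_mem_of_eq (h𝓐.mul_mem_of_eq he.mem (h𝓐.aeval_mem h1 ha.mem _) (mul_one 1))
      he.mem (mul_one 1)
  · rw [← mul_assoc, ← mul_assoc, he.idem]
  · rw [mul_assoc, he.idem]
  · rw [← mul_assoc, ← mul_assoc, ha.right, ← hcomm, hf, he.idem]
  · rw [mul_assoc, ha.left, mul_assoc, hf, he.idem]

/-- Induction on the dimension of `e A`: a nonprimitive `e` splits as `f + (e - f)`, and both right
ideals `f A` and `(e - f) A` are strictly smaller. -/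
theorem exists_finset_isPrimitiveIdempotent [FiniteDimensional F A] (N : ℕ) :
    ∀ e : A, e ∈ 𝓐 1 → e * e = e →
      Module.finrank F (LinearMap.range (LinearMap.mulLeft F e)) < N →
      ∃ S : Finset A, (∀ f ∈ S, IsPrimitiveIdempotent 𝓐 f ∧ e * f = f ∧ f * e = f) ∧
        (∀ f ∈ S, ∀ f' ∈ S, f ≠ f' → f * f' = 0) ∧ ∑ f ∈ S, f = e := by
  classical
  induction N with
  | zero => intro e _ _ h; omega
  | succ N ih =>
    intro e he hee hN
    by_cases h0 : e = 0
    · exact ⟨∅, by simp, by simp, by simp [h0]⟩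
    by_cases hprim : IsPrimitiveIdempotent 𝓐 e
    · exact ⟨{e}, by simpa [hee] using hprim, by simp, by simp⟩
    have : ∃ f ∈ 𝓐 1, f * f = f ∧ e * f = f ∧ f * e = f ∧ f ≠ 0 ∧ f ≠ e := by
      by_contra! hcon
      exact hprim ⟨he, hee, h0, fun f hf hff hef hfe =>
        or_iff_not_imp_left.2 (hcon f hf hff hef hfe)⟩
    obtain ⟨f, hf, hff, hef, hfe, hf0, hfne⟩ := this
    have hlt : ∀ f : A, f * f = f → e * f = f → f * e = f → f ≠ e →
        Module.finrank F (LinearMap.range (LinearMap.mulLeft F f)) < N := by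
      intro f hff hef hfe hfne
      refine lt_of_lt_of_le (Submodule.finrank_lt_finrank_of_lt ?_) (Nat.lt_succ_iff.1 hN)
      refine lt_of_le_of_ne ?_ fun heq => hfne ?_
      · rintro _ ⟨x, rfl⟩
        exact ⟨f * x, by simp [← mul_assoc, hef]⟩
      · have : e ∈ LinearMap.range (LinearMap.mulLeft F f) := heq ▸ ⟨e, by simp [hee]⟩
        obtain ⟨x, hx⟩ := this
        rw [LinearMap.mulLeft_apply] at hx
        rw [← hfe, ← hx, ← mul_assoc, hff]
    have hf' : e - f ∈ 𝓐 1 := sub_mem he hf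
    have hff' : (e - f) * (e - f) = e - f := by
      rw [mul_sub, sub_mul, sub_mul, hee, hef, hfe, hff]; simp
    have hef' : e * (e - f) = e - f := by rw [mul_sub, hee, hef]
    have hfe' : (e - f) * e = e - f := by rw [sub_mul, hee, hfe]
    obtain ⟨S, hS, hSo, hSs⟩ := ih f hf hff (hlt f hff hef hfe hfne)
    obtain ⟨S', hS', hSo', hSs'⟩ := ih (e - f) hf' hff'
      (hlt _ hff' hef' hfe' fun h => hf0 (by simpa using h))
    have horth : ∀ a ∈ S, ∀ b ∈ S', a * b = 0 ∧ b * a = 0 := by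
      intro a ha b hb
      constructor
      · rw [← (hS a ha).2.2, ← (hS' b hb).2.1, mul_assoc, ← mul_assoc f, mul_sub, hfe, hff]
        simp
      · rw [← (hS a ha).2.1, ← (hS' b hb).2.2, mul_assoc, ← mul_assoc _ f, sub_mul, hef, hff]
        simp
    have hdisj : Disjoint S S' := by
      rw [Finset.disjoint_left]
      intro a ha hb
      exact (hS a ha).1.ne_zero ((hS a ha).1.idem ▸ (horth a ha a hb).1)
    refine ⟨S ∪ S', ?_, ?_, ?_⟩
    · intro a ha
      rcases Finset.mem_union.1 ha with ha | ha
      · obtain ⟨h1, h2, h3⟩ := hS a ha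
        exact ⟨h1, by rw [← h2, ← mul_assoc, hef], by rw [← h3, mul_assoc, hfe]⟩
      · obtain ⟨h1, h2, h3⟩ := hS' a ha
        exact ⟨h1, by rw [← h2, ← mul_assoc, hef'], by rw [← h3, mul_assoc, hfe']⟩
    · intro a ha b hb hab
      rcases Finset.mem_union.1 ha with ha | ha <;> rcases Finset.mem_union.1 hb with hb | hb
      · exact hSo a ha b hb hab
      · exact (horth a ha b hb).1
      · exact (horth b hb a ha).2
      · exact hSo' a ha b hb hab
    · rw [Finset.sum_union hdisj, hSs, hSs']
      simp

end Ring

end PrimitiveIdempotents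

end GroupGrading

namespace GroupGrading

/-- Elements `x i ∈ e A` and `y j ∈ A e` such that the products `y i * x j` are matrix units. -/
structure IsMatrixFrame {A : Type*} [Ring A] {s : ℕ} (e : A) (x y : Fin s → A) : Prop where
  left : ∀ i, e * x i = x i
  right : ∀ i, y i * e = y i
  mul : ∀ i j, x i * y j = if i = j then e else 0
  sum : ∑ i, y i * x i = 1

/-! ### Corners as graded division algebras, and homogeneous matrix units -/

section MatrixAlgebra

variable {F : Type*} [Field F] {G : Type*} [CommGroup G] {n : ℕ}
  {𝓡 : G → Submodule F (Matrix (Fin n) (Fin n) F)}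

/-- The matrix ring is prime: a matrix unit joining a nonzero entry of `e` to one of `f` gives `e *
x * f ≠ 0`, and some homogeneous component of `x` must survive. -/
theorem exists_homogeneous_corner_ne_zero [Finite G] (h𝓡 : IsAlgGrading 𝓡)
    {e f : Matrix (Fin n) (Fin n) F} (he : IsPrimitiveIdempotent 𝓡 e)
    (hf : IsPrimitiveIdempotent 𝓡 f) : ∃ g x, MemCorner 𝓡 e f g x ∧ x ≠ 0 := by
  classical
  have := Fintype.ofFinite G
  have hne : ∃ x : Matrix (Fin n) (Fin n) F, e * x * f ≠ 0 := by
    obtain ⟨i, j, hij⟩ : ∃ i j, e i j ≠ 0 := by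
      by_contra! h
      exact he.ne_zero (Matrix.ext h)
    obtain ⟨k, l, hkl⟩ : ∃ k l, f k l ≠ 0 := by
      by_contra! h
      exact hf.ne_zero (Matrix.ext h)
    refine ⟨Matrix.single j k 1, fun h => ?_⟩
    have := congrFun (congrFun h i) l
    rw [Matrix.mul_apply, Finset.sum_eq_single k] at this
    · simp [hij, hkl] at this
    · intro b _ hb
      rw [Matrix.mul_single_apply_of_ne _ _ _ _ _ hb, zero_mul]
    · simp
  obtain ⟨x, hx⟩ := hne
  obtain ⟨y, hy, rfl⟩ := exists_sum_eq_of_iSup_eq_top h𝓡.isInternal.submodule_iSup_eq_top x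
  obtain ⟨g, -, hg⟩ : ∃ g ∈ Finset.univ, e * y g * f ≠ 0 := by
    refine Finset.exists_ne_zero_of_sum_ne_zero ?_
    rwa [Finset.mul_sum, Finset.sum_mul] at hx
  refine ⟨g, e * y g * f, ⟨?_, ?_, ?_⟩, hg⟩
  · exact h𝓡.mul_mem_of_eq (h𝓡.mul_mem_of_eq he.mem (hy g) (one_mul g)) hf.mem (mul_one g)
  · rw [← mul_assoc, ← mul_assoc, he.idem]
  · rw [mul_assoc, hf.idem]

/-- A nonzero homogeneous element of the corner `e R f` of two primitive idempotents is
invertible. -/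
theorem MemCorner.exists_inverse [Finite G] (h𝓡 : IsAlgGrading 𝓡)
    (h1 : (1 : Matrix (Fin n) (Fin n) F) ∈ 𝓡 1) (htr : ∀ g ≠ 1, ∀ X ∈ 𝓡 g, X.trace = 0)
    {e f : Matrix (Fin n) (Fin n) F} (he : IsPrimitiveIdempotent 𝓡 e)
    (hf : IsPrimitiveIdempotent 𝓡 f) {g : G} {x : Matrix (Fin n) (Fin n) F}
    (hx : MemCorner 𝓡 e f g x) (hx0 : x ≠ 0) :
    ∃ y, MemCorner 𝓡 f e g⁻¹ y ∧ x * y = e ∧ y * x = f := by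
  classical
  have := Fintype.ofFinite G
  have hnil : ∀ a : Matrix (Fin n) (Fin n) F, a.trace ≠ 0 → ¬ IsNilpotent a := fun a ha h =>
    ha (Matrix.isNilpotent_trace_of_isNilpotent h).eq_zero
  obtain ⟨z, hz⟩ : ∃ z, (x * z).trace ≠ 0 := by
    by_contra! h
    exact hx0 (Matrix.ext_iff_trace_mul_right.2 fun z => by rw [h z]; simp)
  obtain ⟨y, hy, rfl⟩ := exists_sum_eq_of_iSup_eq_top h𝓡.isInternal.submodule_iSup_eq_top z
  -- Only the component of `z` of degree `g⁻¹` contributes to the trace of `x * z`.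
  rw [Finset.mul_sum, Matrix.trace_sum, Finset.sum_eq_single g⁻¹] at hz
  rotate_left
  · intro h _ hh
    refine htr (g * h) (fun hgh => hh (eq_inv_of_mul_eq_one_right hgh)) _
      (h𝓡.mul_mem _ _ _ _ hx.mem (hy h))
  · simp
  set z := y g⁻¹ with hzdef
  have hzm : MemCorner 𝓡 f e g⁻¹ (f * z * e) := by
    refine ⟨?_, ?_, ?_⟩
    · exact h𝓡.mul_mem_of_eq (h𝓡.mul_mem_of_eq hf.mem (hy _) (one_mul _)) he.mem (mul_one _)
    · rw [← mul_assoc, ← mul_assoc, hf.idem]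
    · rw [mul_assoc, he.idem]
  have hz' : (x * (f * z * e)).trace ≠ 0 := by
    rwa [← mul_assoc, ← mul_assoc, hx.right, Matrix.trace_mul_comm, ← mul_assoc, hx.left]
  clear_value z
  clear hz hzdef
  set w := f * z * e
  -- Both `x * w` and `w * x` have nonzero trace, hence are not nilpotent and are invertible in
  -- their corners. The resulting right and left inverses of `x` coincide.
  obtain ⟨b, hb, hxb, -⟩ := he.exists_inverse_of_not_isNilpotent h𝓡 h1 (a := x * w)
    ⟨h𝓡.mul_mem_of_eq hx.mem hzm.mem (mul_inv_cancel g), by rw [← mul_assoc, hx.left],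
      by rw [mul_assoc, hzm.right]⟩ (hnil _ hz')
  obtain ⟨c, hc, -, hcx⟩ := hf.exists_inverse_of_not_isNilpotent h𝓡 h1 (a := w * x)
    ⟨h𝓡.mul_mem_of_eq hzm.mem hx.mem (inv_mul_cancel g), by rw [← mul_assoc, hzm.left],
      by rw [mul_assoc, hx.right]⟩ (hnil _ (by rwa [Matrix.trace_mul_comm]))
  have heq : w * b = c * w := by
    calc w * b = f * (w * b) := by rw [← mul_assoc, hzm.left]
      _ = c * w * (x * w * b) := by rw [← hcx]; simp only [mul_assoc]
      _ = c * w := by rw [hxb, mul_assoc, hzm.right]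
  refine ⟨w * b, ⟨?_, ?_, ?_⟩, ?_, ?_⟩
  · exact h𝓡.mul_mem_of_eq hzm.mem hb.mem (mul_one _)
  · rw [← mul_assoc, hzm.left]
  · rw [mul_assoc, hb.right]
  · rw [← mul_assoc, hxb]
  · rw [heq, mul_assoc, hcx]

/-- Take an eigenvalue `c` of `a` on the range of `e`. Then `a - c • e` kills a nonzero vector fixed
by `e`, so it is not invertible in the corner and must be zero. -/
theorem MemCorner.exists_eq_smul [Finite G] [IsAlgClosed F] (h𝓡 : IsAlgGrading 𝓡)
    (h1 : (1 : Matrix (Fin n) (Fin n) F) ∈ 𝓡 1) (htr : ∀ g ≠ 1, ∀ X ∈ 𝓡 g, X.trace = 0)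
    {e a : Matrix (Fin n) (Fin n) F} (he : IsPrimitiveIdempotent 𝓡 e)
    (ha : MemCorner 𝓡 e e 1 a) : ∃ c : F, a = c • e := by
  classical
  let W := LinearMap.range (Matrix.toLin' e)
  have hmaps : ∀ w ∈ W, Matrix.toLin' a w ∈ W := by
    rintro _ ⟨v, rfl⟩
    refine ⟨Matrix.toLin' a v, ?_⟩
    rw [← LinearMap.comp_apply, ← LinearMap.comp_apply, ← Matrix.toLin'_mul, ← Matrix.toLin'_mul,
      ha.left, ha.right]
  have hW : Nontrivial W := by
    rw [Submodule.nontrivial_iff_ne_bot]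
    intro h
    refine he.ne_zero (Matrix.toLin'.injective ?_)
    rw [map_zero]
    exact LinearMap.range_eq_bot.1 h
  obtain ⟨c, hc⟩ := Module.End.exists_eigenvalue ((Matrix.toLin' a).restrict hmaps)
  obtain ⟨w, hw⟩ := hc.exists_hasEigenvector
  have hew : Matrix.toLin' e (w : Fin n → F) = w := by
    obtain ⟨v, hv⟩ := w.2
    rw [← hv, ← LinearMap.comp_apply, ← Matrix.toLin'_mul, he.idem]
  have haw : Matrix.toLin' a (w : Fin n → F) = c • (w : Fin n → F) :=
    congrArg Subtype.val hw.apply_eq_smul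
  refine ⟨c, ?_⟩
  by_contra hne
  have hmem : MemCorner 𝓡 e e 1 (a - c • e) :=
    ⟨sub_mem ha.mem (Submodule.smul_mem _ _ he.mem),
      by rw [mul_sub, ha.left, mul_smul_comm, he.idem],
      by rw [sub_mul, ha.right, smul_mul_assoc, he.idem]⟩
  obtain ⟨y, -, -, hy⟩ := hmem.exists_inverse h𝓡 h1 htr he he (sub_ne_zero.2 hne)
  refine hw.2 (Subtype.ext ?_)
  rw [← hew, ← hy, Matrix.toLin'_mul, LinearMap.comp_apply, map_sub, map_smul,
    LinearMap.sub_apply, LinearMap.smul_apply, haw, hew, sub_self, map_zero]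
  rfl

/-- The degrees of the nonzero homogeneous elements of the corner `e R e`. -/
def cornerSupport [Finite G] (h𝓡 : IsAlgGrading 𝓡)
    (h1 : (1 : Matrix (Fin n) (Fin n) F) ∈ 𝓡 1) (htr : ∀ g ≠ 1, ∀ X ∈ 𝓡 g, X.trace = 0)
    {e : Matrix (Fin n) (Fin n) F} (he : IsPrimitiveIdempotent 𝓡 e) : Subgroup G where
  carrier := {g | ∃ x, MemCorner 𝓡 e e g x ∧ x ≠ 0}
  one_mem' := ⟨e, ⟨he.mem, he.idem, he.idem⟩, he.ne_zero⟩
  mul_mem' := by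
    rintro g h ⟨x, hx, hx0⟩ ⟨y, hy, hy0⟩
    refine ⟨x * y, ⟨h𝓡.mul_mem _ _ _ _ hx.mem hy.mem, by rw [← mul_assoc, hx.left],
      by rw [mul_assoc, hy.right]⟩, fun h0 => ?_⟩
    obtain ⟨z, hz, -, hzx⟩ := hx.exists_inverse h𝓡 h1 htr he he hx0
    rw [← hy.left, ← hzx, mul_assoc, h0, mul_zero] at hy0
    exact hy0 rfl
  inv_mem' := by
    rintro g ⟨x, hx, hx0⟩
    obtain ⟨z, hz, hxz, -⟩ := hx.exists_inverse h𝓡 h1 htr he he hx0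
    refine ⟨z, hz, fun h0 => he.ne_zero ?_⟩
    rw [← hxz, h0, mul_zero]

/-- A graded matrix algebra is a matrix algebra over the corner of a primitive idempotent `e`;
the degrees `t i` of the rows are fixed coset representatives of the support of the corner. -/
theorem exists_matrix_frame [Finite G] (hn : 0 < n) (h𝓡 : IsAlgGrading 𝓡)
    (h1 : (1 : Matrix (Fin n) (Fin n) F) ∈ 𝓡 1) (htr : ∀ g ≠ 1, ∀ X ∈ 𝓡 g, X.trace = 0) :
    ∃ (s : ℕ) (e : Matrix (Fin n) (Fin n) F) (he : IsPrimitiveIdempotent 𝓡 e) (t : Fin s → G)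
      (x y : Fin s → Matrix (Fin n) (Fin n) F), 0 < s ∧
      (∀ i, x i ∈ 𝓡 (t i)) ∧ (∀ i, y i ∈ 𝓡 (t i)⁻¹) ∧ IsMatrixFrame e x y ∧
      ∀ i j, (t i)⁻¹ * t j ∈ cornerSupport h𝓡 h1 htr he → t i = t j := by
  classical
  have : Nonempty (Fin n) := ⟨⟨0, hn⟩⟩
  obtain ⟨S, hS, hSo, hS1⟩ := exists_finset_isPrimitiveIdempotent (𝓐 := 𝓡) _ 1 h1 (mul_one 1)
    (Nat.lt_succ_self _)
  have hne : S.Nonempty := by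
    rw [Finset.nonempty_iff_ne_empty]
    rintro rfl
    simp at hS1
  let σ := S.equivFin.symm
  have hs : 0 < S.card := hne.card_pos
  have he := (hS (σ ⟨0, hs⟩) (σ _).2).1
  set e : Matrix (Fin n) (Fin n) F := (σ ⟨0, hs⟩).1
  have hex : ∀ i : Fin S.card, ∃ g : G, ∃ x y,
      MemCorner 𝓡 e (σ i) (g : G ⧸ cornerSupport h𝓡 h1 htr he).out x ∧
      MemCorner 𝓡 (σ i) e (g : G ⧸ cornerSupport h𝓡 h1 htr he).out⁻¹ y ∧
      x * y = e ∧ y * x = σ i := by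
    intro i
    have hi := (hS (σ i) (σ i).2).1
    obtain ⟨g, x, hx, hx0⟩ := exists_homogeneous_corner_ne_zero h𝓡 he hi
    -- The degree of `x` can be moved within its coset by multiplying by an invertible homogeneous
    -- `d` of the corner; it is moved to the chosen representative.
    obtain ⟨⟨h, hh⟩, hout⟩ := QuotientGroup.mk_out_eq_mul (cornerSupport h𝓡 h1 htr he) g
    obtain ⟨d, hd, hd0⟩ := hh
    obtain ⟨d', -, -, hd'⟩ := hd.exists_inverse h𝓡 h1 htr he he hd0
    have hdx : MemCorner 𝓡 e (σ i) (g : G ⧸ cornerSupport h𝓡 h1 htr he).out (d * x) := by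
      refine ⟨?_, by rw [← mul_assoc, hd.left], by rw [mul_assoc, hx.right]⟩
      rw [hout, mul_comm]
      exact h𝓡.mul_mem _ _ _ _ hd.mem hx.mem
    obtain ⟨y, hy⟩ := hdx.exists_inverse h𝓡 h1 htr he hi fun h0 => hx0 (by
      rw [← hx.left, ← hd', mul_assoc, h0, mul_zero])
    exact ⟨g, d * x, y, hdx, hy⟩
  choose g x y hx hy hxy hyx using hex
  refine ⟨S.card, e, he, fun i => (g i : G ⧸ cornerSupport h𝓡 h1 htr he).out, x, y, hs,
    fun i => (hx i).mem, fun i => (hy i).mem,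
    ⟨fun i => (hx i).left, fun i => (hy i).right, fun i j => ?_, ?_⟩, fun i j hij => ?_⟩
  · split_ifs with hij
    · rw [← hij, hxy]
    · rw [← (hx i).right, ← (hy j).left, mul_assoc, ← mul_assoc (σ i : Matrix (Fin n) (Fin n) F),
        hSo _ (σ i).2 _ (σ j).2 (fun h => hij (σ.injective (Subtype.ext h))), zero_mul, mul_zero]
  · simp only [hyx]
    rw [σ.sum_comp (fun a : S => (a : Matrix (Fin n) (Fin n) F)), Finset.sum_coe_sort S fun a => a]
    exact hS1
  · have := QuotientGroup.eq.2 hij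
    rw [QuotientGroup.out_eq', QuotientGroup.out_eq'] at this
    exact congrArg _ this

end MatrixAlgebra

end GroupGrading

namespace GroupGrading

/-! ### Matrix units and the centralizing twisted group algebra -/

section Frame

variable {F : Type*} [Field F] {A : Type*} [Ring A] [Algebra F A] {s : ℕ} {e : A}
  {x y : Fin s → A}

/-- The algebra homomorphism from a matrix algebra given by matrix units. -/
def IsMatrixFrame.algHom (F : Type*) [Field F] [Algebra F A] (h : IsMatrixFrame e x y) :
    Matrix (Fin s) (Fin s) F →ₐ[F] A :=
  AlgHom.ofLinearMap
    { toFun := fun M => ∑ i, ∑ j, M i j • (y i * x j)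
      map_add' := fun M N => by simp [add_smul, Finset.sum_add_distrib]
      map_smul' := fun c M => by simp [mul_smul, Finset.smul_sum] }
    (by
      simp only [LinearMap.coe_mk, AddHom.coe_mk, Matrix.one_apply, ite_smul, one_smul, zero_smul,
        Finset.sum_ite_eq, Finset.mem_univ, if_true]
      exact h.sum)
    (fun M N => by
      have key : ∀ j, x j * ∑ k, ∑ l, N k l • (y k * x l) = ∑ l, N j l • x l := by
        intro j
        rw [Finset.mul_sum, Finset.sum_eq_single j]
        · simp only [Finset.mul_sum, mul_smul_comm, ← mul_assoc, h.mul, if_true, h.left]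
        · intro k _ hk
          simp only [Finset.mul_sum, mul_smul_comm, ← mul_assoc, h.mul, if_neg hk.symm, zero_mul,
            smul_zero, Finset.sum_const_zero]
        · simp
      simp only [LinearMap.coe_mk, AddHom.coe_mk, Matrix.mul_apply, Finset.sum_smul]
      rw [Finset.sum_mul]
      refine Finset.sum_congr rfl fun i _ => ?_
      rw [Finset.sum_mul, Finset.sum_comm]
      refine Finset.sum_congr rfl fun j _ => ?_
      rw [smul_mul_assoc, mul_assoc, key, Finset.mul_sum, Finset.smul_sum]
      simp only [mul_smul_comm, mul_smul])

theorem IsMatrixFrame.algHom_apply (h : IsMatrixFrame e x y) (M : Matrix (Fin s) (Fin s) F) :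
    h.algHom F M = ∑ i, ∑ j, M i j • (y i * x j) := rfl

theorem IsMatrixFrame.algHom_single (h : IsMatrixFrame e x y) (i j : Fin s) :
    h.algHom F (Matrix.single i j 1) = y i * x j := by
  rw [h.algHom_apply, Finset.sum_eq_single i, Finset.sum_eq_single j]
  · simp
  · intro k _ hk
    simp [Matrix.single_apply_of_col_ne _ _ hk.symm]
  · simp
  · intro k _ hk
    simp [Matrix.single_apply_of_row_ne hk.symm]
  · simp

theorem IsMatrixFrame.commute_algHom (h : IsMatrixFrame e x y) {z : A}
    (hz : ∀ i j, Commute (y i * x j) z) (M : Matrix (Fin s) (Fin s) F) :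
    Commute (h.algHom F M) z := by
  rw [h.algHom_apply]
  exact Commute.sum_left _ _ _ fun i _ => Commute.sum_left _ _ _ fun j _ =>
    (hz i j).smul_left _

/-- The diagonal embedding of the corner `e A e` into `A`. -/
def frameDiag (x y : Fin s → A) (d : A) : A := ∑ k, y k * d * x k

theorem IsMatrixFrame.mul_frameDiag (h : IsMatrixFrame e x y) {d : A} (hd : e * d = d)
    (i j : Fin s) : y i * x j * frameDiag x y d = y i * d * x j := by
  rw [frameDiag, Finset.mul_sum, Finset.sum_eq_single j]
  · rw [mul_assoc (y i), ← mul_assoc (x j), ← mul_assoc (x j), h.mul, if_pos rfl, hd, mul_assoc]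
  · intro k _ hk
    rw [mul_assoc (y i), ← mul_assoc (x j), ← mul_assoc (x j), h.mul, if_neg hk.symm, zero_mul,
      zero_mul, mul_zero]
  · simp

theorem IsMatrixFrame.frameDiag_mul (h : IsMatrixFrame e x y) {d : A} (hd : d * e = d)
    (i j : Fin s) : frameDiag x y d * (y i * x j) = y i * d * x j := by
  rw [frameDiag, Finset.sum_mul, Finset.sum_eq_single i]
  · rw [mul_assoc, ← mul_assoc (x i), h.mul, if_pos rfl, ← mul_assoc, mul_assoc (y i), hd]
  · intro k _ hk
    rw [mul_assoc, ← mul_assoc (x k), h.mul, if_neg hk, zero_mul, mul_zero]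
  · simp

theorem IsMatrixFrame.frameDiag_mul_frameDiag (h : IsMatrixFrame e x y) {d d' : A}
    (hd : d * e = d) : frameDiag x y d * frameDiag x y d' = frameDiag x y (d * d') := by
  have key : ∀ k, frameDiag x y d * (y k * d' * x k) = y k * (d * d') * x k := by
    intro k
    have := h.frameDiag_mul hd k
    rw [frameDiag, Finset.sum_mul, Finset.sum_eq_single k]
    · rw [mul_assoc, mul_assoc (y k) d', ← mul_assoc (x k), h.mul, if_pos rfl]
      simp only [mul_assoc]
      rw [← mul_assoc d e, hd]
    · intro l _ hl
      rw [mul_assoc, mul_assoc (y k) d', ← mul_assoc (x l), h.mul, if_neg hl, zero_mul, mul_zero]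
    · simp
  rw [frameDiag.eq_1 x y d', Finset.mul_sum]
  exact Finset.sum_congr rfl fun k _ => key k

theorem IsMatrixFrame.frameDiag_idempotent (h : IsMatrixFrame e x y) : frameDiag x y e = 1 := by
  simp only [frameDiag, h.right, h.sum]

/-- The centralizer of the matrix units is the diagonal copy of the corner: such a `z` is determined
by any one of its diagonal blocks. -/
theorem IsMatrixFrame.eq_frameDiag (h : IsMatrixFrame e x y) {z : A}
    (hz : ∀ i j, Commute (y i * x j) z) (i₀ : Fin s) :
    z = frameDiag x y (x i₀ * z * y i₀) := by
  have key : ∀ k, y k * (x i₀ * z * y i₀) * x k = y k * x k * z := by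
    intro k
    calc y k * (x i₀ * z * y i₀) * x k = (y k * x i₀) * z * (y i₀ * x k) := by
          simp only [mul_assoc]
      _ = (y k * x i₀) * (y i₀ * x k) * z := by
          rw [mul_assoc, ← (hz i₀ k).eq, ← mul_assoc]
      _ = y k * x k * z := by
          rw [mul_assoc (y k), ← mul_assoc (x i₀), h.mul, if_pos rfl, h.left]
  simp only [frameDiag, key, ← Finset.sum_mul, h.sum, one_mul]

end Frame

/-- A graded algebra which is the product of a matrix algebra with an elementary grading and of
a twisted group algebra of the subgroup `H`, centralizing each other. -/
structure IsElementaryTwisted {F : Type*} [Field F] {G : Type*} [CommGroup G] {A : Type*} [Ring A]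
    [Algebra F A] (𝓐 : G → Submodule F A) {s : ℕ} (t : Fin s → G) (H : Subgroup G)
    (E : Matrix (Fin s) (Fin s) F →ₐ[F] A) (u : H → A) : Prop where
  pos : 0 < s
  eq_of_mem : ∀ i j, (t i)⁻¹ * t j ∈ H → t i = t j
  single_mem : ∀ i j, E (Matrix.single i j 1) ∈ 𝓐 ((t i)⁻¹ * t j)
  mem : ∀ h : H, u h ∈ 𝓐 h
  isUnit : ∀ h, IsUnit (u h)
  commute : ∀ M h, Commute (E M) (u h)
  exists_eq_smul : ∀ (h : H), ∀ z ∈ 𝓐 h, (∀ M, Commute (E M) z) → ∃ c : F, z = c • u h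
  span_eq_top : Submodule.span F {z | ∃ i j h, z = E (Matrix.single i j 1) * u h} = ⊤

/-- Each homogeneous component of the corner is a line, since dividing by a nonzero element lands in
the degree `1` part `F e`. The `u h` are the diagonal copies of generators of these lines; because
`G` is commutative, the diagonal embedding preserves degrees. -/
theorem exists_elementary_mul_twistedGroupAlgebra {F : Type*} [Field F] [IsAlgClosed F]
    {G : Type*} [CommGroup G] [Finite G] {n : ℕ} (hn : 0 < n)
    {𝓡 : G → Submodule F (Matrix (Fin n) (Fin n) F)} (h𝓡 : IsAlgGrading 𝓡)
    (h1 : (1 : Matrix (Fin n) (Fin n) F) ∈ 𝓡 1) (htr : ∀ g ≠ 1, ∀ X ∈ 𝓡 g, X.trace = 0) :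
    ∃ (s : ℕ) (t : Fin s → G) (H : Subgroup G)
      (E : Matrix (Fin s) (Fin s) F →ₐ[F] Matrix (Fin n) (Fin n) F)
      (u : H → Matrix (Fin n) (Fin n) F), IsElementaryTwisted 𝓡 t H E u := by
  classical
  have := Fintype.ofFinite G
  obtain ⟨s, e, he, t, x, y, hs, hx, hy, hf, ht⟩ := exists_matrix_frame hn h𝓡 h1 htr
  have hd : ∀ h : cornerSupport h𝓡 h1 htr he, ∃ d, MemCorner 𝓡 e e (h : G) d ∧ d ≠ 0 :=
    fun h => h.2
  choose d hdc hd0 using hd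
  have huniq : ∀ (h : cornerSupport h𝓡 h1 htr he) z, MemCorner 𝓡 e e (h : G) z →
      ∃ c : F, z = c • d h := by
    intro h z hz
    obtain ⟨d', hd', hdd', hd'd⟩ := (hdc h).exists_inverse h𝓡 h1 htr he he (hd0 h)
    obtain ⟨c, hc⟩ := MemCorner.exists_eq_smul h𝓡 h1 htr he (a := z * d')
      ⟨h𝓡.mul_mem_of_eq hz.mem hd'.mem (mul_inv_cancel _), by rw [← mul_assoc, hz.left],
        by rw [mul_assoc, hd'.right]⟩
    refine ⟨c, ?_⟩
    rw [← hz.right, ← hd'd, ← mul_assoc, hc, smul_mul_assoc, (hdc h).left]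
  have hdiag : ∀ {g : G} {z}, MemCorner 𝓡 e e g z → frameDiag x y z ∈ 𝓡 g := by
    intro g z hz
    refine sum_mem fun k _ => h𝓡.mul_mem_of_eq (h𝓡.mul_mem _ _ _ _ (hy k) hz.mem) (hx k) ?_
    rw [mul_comm (t k)⁻¹, inv_mul_cancel_right]
  have hcomm : ∀ (h : cornerSupport h𝓡 h1 htr he) i j, Commute (y i * x j) (frameDiag x y (d h)) :=
    fun h i j => (hf.mul_frameDiag (hdc h).left i j).trans (hf.frameDiag_mul (hdc h).right i j).symm
  refine ⟨s, t, cornerSupport h𝓡 h1 htr he, hf.algHom F, fun h => frameDiag x y (d h), hs, ht,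
    fun i j => ?_, fun h => hdiag (hdc h), fun h => ?_, fun M h => ?_, fun h z hz hzc => ?_, ?_⟩
  · rw [hf.algHom_single]
    exact h𝓡.mul_mem _ _ _ _ (hy i) (hx j)
  · obtain ⟨d', hd', hdd', hd'd⟩ := (hdc h).exists_inverse h𝓡 h1 htr he he (hd0 h)
    refine ⟨⟨_, frameDiag x y d', ?_, ?_⟩, rfl⟩
    · change frameDiag x y (d h) * frameDiag x y d' = 1
      rw [hf.frameDiag_mul_frameDiag (hdc h).right, hdd', hf.frameDiag_idempotent]
    · change frameDiag x y d' * frameDiag x y (d h) = 1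
      rw [hf.frameDiag_mul_frameDiag hd'.right, hd'd, hf.frameDiag_idempotent]
  · exact hf.commute_algHom (hcomm h) M
  · have hzc' : ∀ i j, Commute (y i * x j) z := fun i j => by
      rw [← hf.algHom_single (F := F)]
      exact hzc _
    have hz1 := hf.eq_frameDiag hzc' ⟨0, hs⟩
    obtain ⟨c, hc⟩ := huniq h (x ⟨0, hs⟩ * z * y ⟨0, hs⟩) ⟨h𝓡.mul_mem_of_eq
      (h𝓡.mul_mem _ _ _ _ (hx _) hz) (hy _) (by rw [mul_comm (t _), mul_inv_cancel_right]),
      by rw [← mul_assoc, ← mul_assoc, hf.left], by rw [mul_assoc, hf.right]⟩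
    refine ⟨c, ?_⟩
    rw [hz1, hc]
    simp only [frameDiag, mul_smul_comm, smul_mul_assoc, Finset.smul_sum]
  · rw [eq_top_iff]
    intro z _
    -- Peirce decomposition: the blocks `x i * z * y j` lie in the corner `e R e`.
    have hz : z = ∑ i, ∑ j, y i * (x i * z * y j) * x j := by
      calc z = (∑ i, y i * x i) * z * ∑ j, y j * x j := by rw [hf.sum, one_mul, mul_one]
        _ = _ := by
          rw [Finset.sum_mul, Finset.sum_mul_sum]
          simp only [mul_assoc]
    rw [hz]
    refine sum_mem fun i _ => sum_mem fun j _ => ?_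
    have hcorner : ∀ w, e * w * e = w → y i * w * x j ∈
        Submodule.span F {z | ∃ i j h, z = hf.algHom F (Matrix.single i j 1) *
          (fun h => frameDiag x y (d h)) h} := by
      intro w hw
      obtain ⟨v, hv, hsum⟩ := exists_sum_eq_of_iSup_eq_top h𝓡.isInternal.submodule_iSup_eq_top w
      have hw' : w = ∑ g, e * v g * e := by
        rw [← Finset.sum_mul, ← Finset.mul_sum, hsum, hw]
      rw [hw', Finset.mul_sum, Finset.sum_mul]
      refine sum_mem fun g _ => ?_
      by_cases h0 : e * v g * e = 0
      · rw [h0, mul_zero, zero_mul]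
        exact zero_mem _
      · have hm : MemCorner 𝓡 e e g (e * v g * e) :=
          ⟨h𝓡.mul_mem_of_eq (h𝓡.mul_mem_of_eq he.mem (hv g) (one_mul g)) he.mem (mul_one g),
            by rw [← mul_assoc, ← mul_assoc, he.idem], by rw [mul_assoc, he.idem]⟩
        obtain ⟨c, hc⟩ := huniq ⟨g, _, hm, h0⟩ _ hm
        rw [hc, mul_smul_comm, smul_mul_assoc]
        refine Submodule.smul_mem _ _ (Submodule.subset_span ⟨i, j, ⟨g, _, hm, h0⟩, ?_⟩)
        rw [hf.algHom_single, hf.mul_frameDiag (hdc _).left]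
    refine hcorner _ ?_
    rw [← mul_assoc, ← mul_assoc, hf.left, mul_assoc, hf.right]

end GroupGrading

namespace GroupGrading

/-! ### Alternating bicharacters on finite abelian groups -/

section Symplectic

variable {A : Type*} [CommGroup A] {F : Type*} [Field F]

theorem bicharacter_apply_eq_inv (β : A →* A →* Fˣ) (halt : ∀ a, β a a = 1) (a b : A) :
    β a b = (β b a)⁻¹ := by
  have := halt (a * b)
  rw [map_mul β, MonoidHom.mul_apply, map_mul, map_mul, halt, halt, one_mul, mul_one] at this
  exact eq_inv_of_mul_eq_one_left this

/-- The members of mutually orthogonal hyperbolic pairs are independent. -/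
theorem dvd_of_prod_pow_mul_pow_eq_one (β : A →* A →* Fˣ) (halt : ∀ a, β a a = 1) {k : ℕ}
    {m : Fin k → ℕ} {a b : Fin k → A} (hroot : ∀ i, IsPrimitiveRoot (β (a i) (b i)) (m i))
    (horth : ∀ i j, i ≠ j → β (a i) (a j) = 1 ∧ β (a i) (b j) = 1 ∧ β (b i) (b j) = 1)
    {p q : Fin k → ℕ} (h : ∏ i, a i ^ p i * b i ^ q i = 1) (i : Fin k) :
    m i ∣ p i ∧ m i ∣ q i := by
  have hskew := bicharacter_apply_eq_inv β halt
  constructor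
  · have h1 := congrArg (β (b i)) h
    rw [map_one, map_prod, Finset.prod_eq_single i] at h1
    · rw [map_mul, map_pow, map_pow, halt, one_pow, mul_one, hskew, inv_pow, inv_eq_one] at h1
      exact (hroot i).dvd_of_pow_eq_one _ h1
    · intro j _ hj
      rw [map_mul, map_pow, map_pow, hskew, (horth j i hj).2.1, (horth i j hj.symm).2.2]
      simp
    · simp
  · have h1 := congrArg (β (a i)) h
    rw [map_one, map_prod, Finset.prod_eq_single i] at h1
    · rw [map_mul, map_pow, map_pow, halt, one_pow, one_mul] at h1
      exact (hroot i).dvd_of_pow_eq_one _ h1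
    · intro j _ hj
      rw [map_mul, map_pow, map_pow, (horth i j hj.symm).1, (horth i j hj.symm).2.1]
      simp
    · simp

/-- Take `a` of maximal order `m`, and `b` such that `β a b` generates the cyclic group of values of
`β a` on `K`. Nondegeneracy makes `β a b` a primitive `m`-th root, so the pair splits off and
induction applies to its orthogonal complement `K'`. The bound `N` drives the induction on the order
of `K`. -/
theorem exists_symplectic_generators_subgroup [Finite A] (β : A →* A →* Fˣ)
    (halt : ∀ a, β a a = 1) (N : ℕ) : ∀ K : Subgroup A, Nat.card K < N →
      (∀ a ∈ K, (∀ b ∈ K, β a b = 1) → a = 1) →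
      ∃ (k : ℕ) (m : Fin k → ℕ) (a b : Fin k → A), (∀ i, 0 < m i) ∧
        (∀ i, a i ∈ K) ∧ (∀ i, b i ∈ K) ∧ (∀ i, a i ^ m i = 1) ∧ (∀ i, b i ^ m i = 1) ∧
        (∀ i, IsPrimitiveRoot (β (a i) (b i)) (m i)) ∧
        (∀ i j, i ≠ j → β (a i) (a j) = 1 ∧ β (a i) (b j) = 1 ∧ β (b i) (b j) = 1) ∧
        ∀ h ∈ K, ∃ p q : Fin k → ℕ, h = ∏ i, a i ^ p i * b i ^ q i := by
  have hskew := bicharacter_apply_eq_inv β halt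
  induction N with
  | zero => intro K h; omega
  | succ N ih =>
    intro K hK hnd
    by_cases hbot : K = ⊥
    · refine ⟨0, Fin.elim0, Fin.elim0, Fin.elim0, fun i => i.elim0, fun i => i.elim0,
        fun i => i.elim0, fun i => i.elim0, fun i => i.elim0, fun i => i.elim0,
        fun i => i.elim0, fun h hh => ⟨Fin.elim0, Fin.elim0, ?_⟩⟩
      rw [hbot, Subgroup.mem_bot] at hh
      simpa using hh
    obtain ⟨⟨a, haK⟩, ha⟩ := Monoid.exists_orderOf_eq_exponent (G := K)
      Monoid.ExponentExists.of_finite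
    set m := Monoid.exponent K with hm
    have hm0 : 0 < m := Nat.pos_of_ne_zero Monoid.exponent_ne_zero_of_finite
    have hpow : ∀ x ∈ K, x ^ m = 1 := fun x hx =>
      congrArg Subtype.val (Monoid.pow_exponent_eq_one (⟨x, hx⟩ : K))
    rw [Subgroup.orderOf_mk] at ha
    have hm1 : m ≠ 1 := by
      intro h1
      refine hbot ((Subgroup.eq_bot_iff_forall K).2 fun x hx => ?_)
      have := hpow x hx
      rwa [h1, pow_one] at this
    have : Finite ((β a).comp K.subtype).range :=
      Finite.of_surjective _ ((β a).comp K.subtype).rangeRestrict_surjective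
    obtain ⟨⟨_, ⟨b, hbK⟩, rfl⟩, hgen⟩ :=
      IsCyclic.exists_generator (α := ((β a).comp K.subtype).range)
    have hroot : IsPrimitiveRoot (β a b) m := by
      have h1 : (β a b) ^ m = 1 := by
        rw [← map_pow, hpow b hbK, map_one]
      -- Every value `β a c` is a power of `β a b`, so this power of `a` is in the radical.
      have h2 : a ^ orderOf (β a b) = 1 := by
        refine hnd _ (K.pow_mem haK _) fun c hc => ?_
        obtain ⟨z, hz⟩ := hgen ⟨β a c, ⟨c, hc⟩, rfl⟩
        have hz' : (β a b) ^ z = β a c := congrArg Subtype.val hz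
        rw [map_pow, MonoidHom.pow_apply, ← hz', ← zpow_natCast, ← zpow_mul, mul_comm, zpow_mul,
          zpow_natCast, pow_orderOf_eq_one, one_zpow]
      have h3 : orderOf (β a b) = m := Nat.dvd_antisymm (orderOf_dvd_of_pow_eq_one h1)
        (ha ▸ orderOf_dvd_of_pow_eq_one h2)
      exact h3 ▸ IsPrimitiveRoot.orderOf _
    have hlog : ∀ z : Fˣ, z ^ m = 1 → ∃ i, (β a b) ^ i = z := by
      intro z hz
      obtain ⟨i, -, hi⟩ := (IsPrimitiveRoot.coe_units_iff.2 hroot).eq_pow_of_pow_eq_one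
        (ξ := (z : F)) (by rw [← Units.val_pow_eq_pow_val, hz, Units.val_one])
      exact ⟨i, Units.ext (by rw [Units.val_pow_eq_pow_val, hi])⟩
    let K' : Subgroup A := K ⊓ ((β a).ker ⊓ (β b).ker)
    have hmemK' : ∀ x, x ∈ K' ↔ x ∈ K ∧ β a x = 1 ∧ β b x = 1 := fun x => Iff.rfl
    -- Projection onto the pair: `q` is read off from `β a y`, and `p` from `β b y`, inverted
    -- because `β b a = (β a b)⁻¹`.
    have hdec : ∀ y ∈ K, ∃ p q : ℕ, ∃ y' ∈ K', y = a ^ p * b ^ q * y' := by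
      intro y hy
      obtain ⟨q, hq⟩ := hlog (β a y) (by rw [← map_pow, hpow y hy, map_one])
      obtain ⟨p, hp⟩ := hlog (β b y)⁻¹ (by rw [inv_pow, ← map_pow, hpow y hy, map_one, inv_one])
      refine ⟨p, q, (a ^ p * b ^ q)⁻¹ * y, (hmemK' _).2 ⟨?_, ?_, ?_⟩, by group⟩
      · exact K.mul_mem (K.inv_mem (K.mul_mem (K.pow_mem haK _) (K.pow_mem hbK _))) hy
      · rw [map_mul, map_inv, map_mul, map_pow, map_pow, halt, hq, one_pow, one_mul,
          inv_mul_cancel]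
      · rw [map_mul, map_inv, map_mul, map_pow, map_pow, halt, hskew b a, one_pow, mul_one,
          inv_pow, inv_inv, hp, inv_mul_cancel]
    have hlt : Nat.card K' < Nat.card K := by
      have hss : (K' : Set A) ⊂ (K : Set A) := by
        refine ⟨fun x hx => hx.1, fun hle => hm1 ?_⟩
        have : β a b = 1 := ((hmemK' b).1 (hle hbK)).2.1
        rw [this] at hroot
        exact hroot.unique IsPrimitiveRoot.one
      exact Set.Finite.card_lt_card (Set.toFinite _) hss
    -- Nondegeneracy passes to `K'`: its elements are already orthogonal to `a` and `b`, which
    -- together with `K'` generate `K`.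
    obtain ⟨k, m', a', b', h1, h2, h3, h4, h5, h6, h7, h8⟩ := ih K' (by omega) (by
      intro x hx hx1
      refine hnd x hx.1 fun y hy => ?_
      obtain ⟨p, q, y', hy', rfl⟩ := hdec y hy
      have hx' := (hmemK' x).1 hx
      rw [map_mul, map_mul, map_pow, map_pow, hskew x a, hskew x b, hx'.2.1, hx'.2.2, hx1 y' hy']
      simp)
    refine ⟨k + 1, Fin.cons m m', Fin.cons a a', Fin.cons b b', ?_, ?_, ?_, ?_, ?_, ?_, ?_, ?_⟩
    · exact Fin.cases hm0 h1
    · exact Fin.cases haK fun i => (h2 i).1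
    · exact Fin.cases hbK fun i => (h3 i).1
    · exact Fin.cases (hpow a haK) h4
    · exact Fin.cases (hpow b hbK) h5
    · exact Fin.cases hroot h6
    · have ha' := fun i => (hmemK' _).1 (h2 i)
      have hb' := fun i => (hmemK' _).1 (h3 i)
      intro i j
      refine Fin.cases ?_ (fun i => ?_) i <;> refine Fin.cases ?_ (fun j => ?_) j
      · exact fun h => absurd rfl h
      · exact fun _ => ⟨(ha' j).2.1, (hb' j).2.1, (hb' j).2.2⟩
      · intro _
        simp only [Fin.cons_succ, Fin.cons_zero]
        rw [hskew (a' i) a, hskew (a' i) b, hskew (b' i) b, (ha' i).2.1, (ha' i).2.2,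
          (hb' i).2.2]
        simp
      · exact fun h => h7 i j fun hij => h (congrArg _ hij)
    · intro y hy
      obtain ⟨p, q, y', hy', rfl⟩ := hdec y hy
      obtain ⟨p', q', rfl⟩ := h8 y' hy'
      exact ⟨Fin.cons p p', Fin.cons q q', by simp [Fin.prod_univ_succ]⟩

/-- A finite abelian group with a nondegenerate alternating bicharacter is generated by mutually
orthogonal hyperbolic pairs. -/
theorem exists_symplectic_generators [Finite A] (β : A →* A →* Fˣ) (halt : ∀ a, β a a = 1)
    (hnd : ∀ a, (∀ b, β a b = 1) → a = 1) :
    ∃ (k : ℕ) (m : Fin k → ℕ) (a b : Fin k → A), (∀ i, 0 < m i) ∧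
      (∀ i, a i ^ m i = 1) ∧ (∀ i, b i ^ m i = 1) ∧
      (∀ i, IsPrimitiveRoot (β (a i) (b i)) (m i)) ∧
      (∀ i j, i ≠ j → β (a i) (a j) = 1 ∧ β (a i) (b j) = 1 ∧ β (b i) (b j) = 1) ∧
      ∀ h, ∃ p q : Fin k → ℕ, h = ∏ i, a i ^ p i * b i ^ q i := by
  obtain ⟨k, m, a, b, h1, -, -, h4, h5, h6, h7, h8⟩ := exists_symplectic_generators_subgroup β halt
    _ ⊤ (Nat.lt_succ_self _) fun a _ ha => hnd a fun b => ha b (Subgroup.mem_top b)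
  exact ⟨k, m, a, b, h1, h4, h5, h6, h7, fun h => h8 h (Subgroup.mem_top h)⟩

end Symplectic

/-! ### Clock and shift relations -/

section Clock

variable {F : Type*} [Field F] {A : Type*} [Ring A] [Algebra F A]

theorem mul_pow_of_mul_eq_smul {ε : F} {X Y : A} (h : X * Y = ε • (Y * X)) (k : ℕ) :
    X * Y ^ k = ε ^ k • (Y ^ k * X) := by
  induction k with
  | zero => simp
  | succ k ih =>
    rw [pow_succ, ← mul_assoc, ih, smul_mul_assoc, mul_assoc, h, mul_smul_comm, smul_smul,
      ← pow_succ, mul_assoc]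

theorem pow_mul_pow_of_mul_eq_smul {ε : F} {X Y : A} (h : X * Y = ε • (Y * X)) (r k : ℕ) :
    X ^ r * Y ^ k = (ε ^ r) ^ k • (Y ^ k * X ^ r) := by
  induction r with
  | zero => simp
  | succ r ih =>
    rw [pow_succ', mul_assoc, ih, mul_smul_comm, ← mul_assoc, mul_pow_of_mul_eq_smul h,
      smul_mul_assoc, smul_smul, mul_assoc, ← mul_pow, ← pow_succ]

theorem sum_pow_pow_eq_ite {ε : F} {m : ℕ} (hε : IsPrimitiveRoot ε m) {r : ℕ} (hr : r < m) :
    ∑ i ∈ Finset.range m, (ε ^ r) ^ i = if r = 0 then (m : F) else 0 := by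
  split_ifs with h
  · simp [h]
  · have h1 : ε ^ r ≠ 1 := hε.pow_ne_one_of_pos_of_lt h hr
    have := mul_geom_sum (ε ^ r) m
    rw [← pow_mul, mul_comm r, pow_mul, hε.pow_eq_one, one_pow, sub_self] at this
    exact (mul_eq_zero.1 this).resolve_left (sub_ne_zero.2 h1)

/-- `P` is the spectral projector of `X` for the eigenvalue `ε⁻¹`, the first diagonal entry of
`matXa`. Powers of `Y` permute the eigenspaces of `X` cyclically, which supplies the off-diagonal
matrix units. -/
theorem exists_isMatrixFrame_of_clock_shift [CharZero F] {ε : F} {m : ℕ} (hm : 0 < m)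
    (hε : IsPrimitiveRoot ε m) {X Y : A} (hX : X ^ m = 1) (hY : Y ^ m = 1)
    (hXY : X * Y = ε • (Y * X)) :
    ∃ P : A, ε • (X * P) = P ∧ (∀ z, Commute X z → Commute P z) ∧ P * P = P ∧
      IsMatrixFrame P (fun j : Fin m => P * Y ^ (j : ℕ)) (fun i => Y ^ (m - i) * P) := by
  have hm0 : (m : F) ≠ 0 := by exact_mod_cast hm.ne'
  set Q : A := ∑ r ∈ Finset.range m, ε ^ r • X ^ r with hQ
  have hXQ : ε • (X * Q) = Q := by
    have : ε • (X * Q) = ∑ r ∈ Finset.range m, ε ^ (r + 1) • X ^ (r + 1) := by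
      rw [hQ, Finset.mul_sum, Finset.smul_sum]
      refine Finset.sum_congr rfl fun r _ => ?_
      rw [mul_smul_comm, smul_smul, ← pow_succ', ← pow_succ']
    have h2 := (Finset.sum_range_succ (fun r => ε ^ r • X ^ r) m).symm.trans
      (Finset.sum_range_succ' (fun r => ε ^ r • X ^ r) m)
    rw [hε.pow_eq_one, hX, pow_zero, pow_zero] at h2
    rw [this, hQ]
    exact (add_right_cancel h2).symm
  obtain ⟨P, hP⟩ : ∃ P : A, P = (m : F)⁻¹ • Q := ⟨_, rfl⟩
  have hXP : ε • (X * P) = P := by rw [hP, mul_smul_comm, smul_comm, hXQ]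
  have hcomm : ∀ z, Commute X z → Commute P z := fun z hz => by
    rw [hP]
    exact (Commute.sum_left _ _ _ fun r _ => (hz.pow_left r).smul_left _).smul_left _
  have hXrP : ∀ r, ε ^ r • (X ^ r * P) = P := by
    intro r
    induction r with
    | zero => simp
    | succ r ih =>
      rw [pow_succ X, mul_assoc, pow_succ, mul_smul, ← mul_smul_comm, hXP, ih]
  have hPP : P * P = P := by
    nth_rewrite 1 [hP]
    rw [hQ, smul_mul_assoc, Finset.sum_mul]
    simp only [smul_mul_assoc, hXrP, Finset.sum_const, Finset.card_range]
    rw [← Nat.cast_smul_eq_nsmul F, smul_smul, inv_mul_cancel₀ hm0, one_smul]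
  -- Multiplying `P * Y ^ k * P` on the left by `ε • X` gives both the element itself and `ε ^ k`
  -- times it.
  have hPYP : ∀ k, ¬ m ∣ k → P * Y ^ k * P = 0 := by
    intro k hk
    have h1 : ε • (X * (P * Y ^ k * P)) = P * Y ^ k * P := by
      rw [mul_assoc P, ← mul_assoc, ← smul_mul_assoc, hXP]
    have h2 : ε • (X * (P * Y ^ k * P)) = ε ^ k • (P * Y ^ k * P) := by
      have : X * (P * Y ^ k * P) = P * (X * Y ^ k) * P := by
        rw [← mul_assoc, ← mul_assoc, ← (hcomm X (Commute.refl X)).eq, mul_assoc P]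
      rw [this, mul_pow_of_mul_eq_smul hXY, mul_smul_comm, smul_mul_assoc, smul_comm ε,
        ← mul_assoc P, mul_assoc _ X, ← mul_smul_comm, hXP]
    have h3 : (ε ^ k - 1) • (P * Y ^ k * P) = 0 := by
      rw [sub_smul, ← h2, h1, one_smul, sub_self]
    exact (smul_eq_zero.1 h3).resolve_left fun h =>
      hk ((hε.pow_eq_one_iff_dvd k).1 (sub_eq_zero.1 h))
  refine ⟨P, hXP, hcomm, hPP, ⟨fun i => by rw [← mul_assoc, hPP], fun i => by rw [mul_assoc, hPP],
    fun i j => ?_, ?_⟩⟩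
  · have h1 : P * Y ^ (i : ℕ) * (Y ^ (m - j) * P) = P * Y ^ (i + (m - j) : ℕ) * P := by
      rw [pow_add]
      simp only [mul_assoc]
    rw [h1]
    split_ifs with hij
    · rw [hij, Nat.add_sub_cancel' j.2.le, hY, mul_one, hPP]
    · refine hPYP _ fun hdvd => hij (Fin.ext ?_)
      have hi := i.2
      have hj := j.2
      obtain ⟨c, hc⟩ := hdvd
      have hc2 : c < 2 := by
        by_contra! h
        have := Nat.mul_le_mul_left m h
        omega
      interval_cases c <;> omega
  · have h1 : ∀ i : Fin m, Y ^ (m - i) * P * (P * Y ^ (i : ℕ)) =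
        (m : F)⁻¹ • ∑ r ∈ Finset.range m, (ε ^ r * (ε ^ r) ^ (i : ℕ)) • X ^ r := by
      intro i
      rw [mul_assoc, ← mul_assoc P, hPP, hP, hQ, smul_mul_assoc, mul_smul_comm, Finset.sum_mul,
        Finset.mul_sum]
      congr 1
      refine Finset.sum_congr rfl fun r _ => ?_
      rw [smul_mul_assoc, pow_mul_pow_of_mul_eq_smul hXY, smul_smul, mul_smul_comm, ← mul_assoc,
        ← pow_add, Nat.sub_add_cancel i.2.le, hY, one_mul]
    simp only [h1]
    rw [← Finset.smul_sum, Fin.sum_univ_eq_sum_range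
      (fun i => ∑ r ∈ Finset.range m, (ε ^ r * (ε ^ r) ^ i) • X ^ r) m, Finset.sum_comm]
    -- Orthogonality of roots of unity leaves only `r = 0` in the sum of the conjugates of `P`.
    have h2 : ∀ r ∈ Finset.range m, ∑ i ∈ Finset.range m, (ε ^ r * (ε ^ r) ^ i) • X ^ r =
        if r = 0 then (m : F) • (1 : A) else 0 := by
      intro r hr
      rw [← Finset.sum_smul, ← Finset.mul_sum, sum_pow_pow_eq_ite hε (Finset.mem_range.1 hr)]
      split_ifs with h
      · simp [h]
      · simp
    rw [Finset.sum_congr rfl h2, Finset.sum_ite_eq', if_pos (Finset.mem_range.2 hm), smul_smul,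
      inv_mul_cancel₀ hm0, one_smul]

/-- Two elements satisfying the relations of the clock and shift matrices generate a matrix
algebra. -/
theorem exists_algHom_of_clock_shift [CharZero F] {ε : F} {m : ℕ} (hm : 0 < m)
    (hε : IsPrimitiveRoot ε m) {X Y : A} (hX : X ^ m = 1) (hY : Y ^ m = 1)
    (hXY : X * Y = ε • (Y * X)) :
    ∃ f : Matrix (Fin m) (Fin m) F →ₐ[F] A, f (matXa m ε) = X ∧ f (matXb F m) = Y ∧
      ∀ z, Commute X z → Commute Y z → ∀ M, Commute (f M) z := by
  obtain ⟨P, hXP, hcomm, hPP, hf⟩ := exists_isMatrixFrame_of_clock_shift hm hε hX hY hXY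
  refine ⟨hf.algHom F, ?_, ?_, fun z hXz hYz => hf.commute_algHom fun i j => ?_⟩
  · have h1 : hf.algHom F (matXa m ε) =
        ∑ i : Fin m, X * (Y ^ (m - i) * P * (P * Y ^ (i : ℕ))) := by
      rw [hf.algHom_apply]
      refine Finset.sum_congr rfl fun i _ => ?_
      rw [Finset.sum_eq_single i]
      · have h2 : X * (Y ^ (m - i) * P) = ε ^ (m - 1 - i) • (Y ^ (m - i) * P) := by
          have h3 : m - (i : ℕ) = m - 1 - i + 1 := by have := i.2; omega
          rw [← mul_assoc, mul_pow_of_mul_eq_smul hXY, smul_mul_assoc, mul_assoc]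
          nth_rewrite 1 [h3]
          rw [pow_succ, mul_smul, ← mul_smul_comm, hXP]
        rw [← mul_assoc X, h2, smul_mul_assoc, matXa, Matrix.diagonal_apply_eq]
      · intro j _ hj
        rw [matXa, Matrix.diagonal_apply_ne _ hj.symm, zero_smul]
      · simp
    rw [h1, ← Finset.mul_sum, hf.sum, mul_one]
  · have h1 : hf.algHom F (matXb F m) = ∑ i : Fin m, (Y ^ (m - i) * P * (P * Y ^ (i : ℕ))) * Y := by
      rw [hf.algHom_apply]
      refine Finset.sum_congr rfl fun i _ => ?_
      rw [Finset.sum_eq_single ⟨((i : ℕ) + 1) % m, Nat.mod_lt _ hm⟩]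
      · simp only [matXb, Matrix.of_apply, if_true, one_smul]
        rw [← pow_eq_pow_mod _ hY, pow_succ]
        simp only [mul_assoc]
      · intro j _ hj
        rw [matXb, Matrix.of_apply, if_neg fun h => hj (Fin.ext h), zero_smul]
      · simp
    rw [h1, ← Finset.sum_mul, hf.sum, one_mul]
  · exact (((hYz.pow_left _).mul_left (hcomm z hXz))).mul_left
      ((hcomm z hXz).mul_left (hYz.pow_left _))

theorem isUnit_matXa {ε : F} {m : ℕ} (hm : 0 < m) (hε : IsPrimitiveRoot ε m) :
    IsUnit (matXa m ε) := by
  rw [matXa, Matrix.isUnit_iff_isUnit_det, Matrix.det_diagonal, isUnit_iff_ne_zero]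
  exact Finset.prod_ne_zero_iff.2 fun i _ => pow_ne_zero _ (hε.ne_zero hm.ne')

theorem matXb_pow_apply {m : ℕ} (hm : 0 < m) (k : ℕ) (i j : Fin m) :
    (matXb F m ^ k) i j = if (j : ℕ) = ((i : ℕ) + k) % m then 1 else 0 := by
  induction k generalizing j with
  | zero =>
    rw [pow_zero, Matrix.one_apply, add_zero, Nat.mod_eq_of_lt i.2]
    simp only [Fin.ext_iff, eq_comm]
  | succ k ih =>
    rw [pow_succ, Matrix.mul_apply, Finset.sum_eq_single ⟨((i : ℕ) + k) % m, Nat.mod_lt _ hm⟩]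
    · rw [ih, if_pos rfl, one_mul, matXb, Matrix.of_apply, Nat.mod_add_mod, add_assoc]
    · intro l _ hl
      rw [ih, if_neg fun h => hl (Fin.ext h), zero_mul]
    · simp

theorem matXb_pow_eq_one {m : ℕ} (hm : 0 < m) : matXb F m ^ m = 1 := by
  ext i j
  rw [matXb_pow_apply hm, Nat.add_mod_right, Nat.mod_eq_of_lt i.2, Matrix.one_apply]
  simp only [Fin.ext_iff, eq_comm]

theorem isUnit_matXb {m : ℕ} (hm : 0 < m) : IsUnit (matXb F m) :=
  IsUnit.of_pow_eq_one (matXb_pow_eq_one hm) hm.ne'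

end Clock

end GroupGrading

namespace GroupGrading

/-! ### The commutation bicharacter and the twisted group algebra -/

section Bicharacter

variable {F : Type*} [Field F] {A : Type*} [Ring A] [Nontrivial A] [Algebra F A]

theorem eq_of_smul_eq_smul_of_isUnit {c c' : F} {w : A} (hw : IsUnit w) (h : c • w = c' • w) : c = c' := by
  by_contra hne
  have h0 : (c - c') • w = 0 := by rw [sub_smul, h, sub_self]
  exact hw.ne_zero ((smul_eq_zero.1 h0).resolve_left (sub_ne_zero.2 hne))

/-- Commutation factors are unique because products of units are nonzero, and multiplicative because
`u (h * h')` is proportional to `u h * u h'`. -/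
theorem exists_commutation_bicharacter {H : Type*} [CommGroup H] {u : H → A}
    (hu : ∀ h, IsUnit (u h)) (hmul : ∀ h h', ∃ c : Fˣ, u h * u h' = (c : F) • u (h * h')) :
    ∃ β : H →* H →* Fˣ, (∀ h, β h h = 1) ∧
      ∀ h h', u h * u h' = (β h h' : F) • (u h' * u h) := by
  have hex : ∀ h h', ∃ c : Fˣ, u h * u h' = (c : F) • (u h' * u h) := by
    intro h h'
    obtain ⟨c, hc⟩ := hmul h h'
    obtain ⟨d, hd⟩ := hmul h' h
    refine ⟨c * d⁻¹, ?_⟩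
    rw [hc, hd, mul_comm h', smul_smul, Units.val_mul, mul_assoc, Units.inv_mul, mul_one]
  choose b hb using hex
  have huniq : ∀ h h' (c : Fˣ), u h * u h' = (c : F) • (u h' * u h) → b h h' = c :=
    fun h h' c hc => Units.ext (eq_of_smul_eq_smul_of_isUnit ((hu h').mul (hu h)) ((hb h h').symm.trans hc))
  have hself : ∀ h, b h h = 1 := fun h => huniq _ _ _ (by simp)
  have hskew : ∀ h h', b h h' = (b h' h)⁻¹ := fun h h' => huniq _ _ _ (by
    rw [hb h' h, smul_smul, Units.inv_mul, one_smul])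
  have hright : ∀ h h₁ h₂, b h (h₁ * h₂) = b h h₁ * b h h₂ := by
    intro h h₁ h₂
    obtain ⟨c, hc⟩ := hmul h₁ h₂
    have hc' : u (h₁ * h₂) = ((c⁻¹ : Fˣ) : F) • (u h₁ * u h₂) := by
      rw [hc, smul_smul, Units.inv_mul, one_smul]
    refine huniq _ _ _ ?_
    rw [hc', mul_smul_comm, smul_mul_assoc, smul_comm _ ((c⁻¹ : Fˣ) : F), ← mul_assoc, hb h h₁,
      smul_mul_assoc, mul_assoc, hb h h₂, mul_smul_comm, smul_smul, mul_assoc, mul_smul,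
      Units.val_mul, mul_smul]
  have hleft : ∀ h₁ h₂ h, b (h₁ * h₂) h = b h₁ h * b h₂ h := by
    intro h₁ h₂ h
    rw [hskew, hright, mul_inv, ← hskew, ← hskew]
  exact ⟨MonoidHom.mk' (fun h => MonoidHom.mk' (b h) (hright h))
    (fun h₁ h₂ => MonoidHom.ext fun h => hleft h₁ h₂ h), hself, hb⟩

end Bicharacter

namespace IsElementaryTwisted

variable {F : Type*} [Field F] {G : Type*} [CommGroup G] {A : Type*} [Ring A] [Nontrivial A]
  [Algebra F A] {𝓐 : G → Submodule F A} {s : ℕ} {t : Fin s → G} {H : Subgroup G}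
  {E : Matrix (Fin s) (Fin s) F →ₐ[F] A} {u : H → A}

theorem exists_eq_units_smul (hE : IsElementaryTwisted 𝓐 t H E u) (h : H) {z : A} (hz : z ∈ 𝓐 h)
    (hzE : ∀ M, Commute (E M) z) (hzu : IsUnit z) : ∃ c : Fˣ, z = (c : F) • u h := by
  obtain ⟨c, rfl⟩ := hE.exists_eq_smul h z hz hzE
  refine ⟨Units.mk0 c fun hc => hzu.ne_zero ?_, rfl⟩
  rw [hc, zero_smul]

theorem exists_mul_eq (hE : IsElementaryTwisted 𝓐 t H E u) (h𝓐 : IsAlgGrading 𝓐) (h h' : H) :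
    ∃ c : Fˣ, u h * u h' = (c : F) • u (h * h') :=
  hE.exists_eq_units_smul _ (h𝓐.mul_mem _ _ _ _ (hE.mem h) (hE.mem h'))
    (fun M => (hE.commute M h).mul_right (hE.commute M h')) ((hE.isUnit h).mul (hE.isUnit h'))

/-- Both `u h ^ m` and `1` are nonzero multiples of `u 1`, so rescaling by an `m`-th root of their
ratio suffices. -/
theorem exists_smul_pow_eq_one [IsAlgClosed F] (hE : IsElementaryTwisted 𝓐 t H E u)
    (h𝓐 : IsAlgGrading 𝓐) (h1 : (1 : A) ∈ 𝓐 1) {m : ℕ} (hm : 0 < m) (h : H) (hh : h ^ m = 1) :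
    ∃ c : F, (c • u h) ^ m = 1 := by
  have hh' : (h : G) ^ m = 1 := by rw [← Subgroup.coe_pow, hh, Subgroup.coe_one]
  obtain ⟨c, hc⟩ := hE.exists_eq_units_smul 1 (z := u h ^ m)
    (by have := h𝓐.pow_mem h1 (hE.mem h) m; rwa [hh'] at this)
    (fun M => (hE.commute M h).pow_right m) ((hE.isUnit h).pow m)
  obtain ⟨d, hd⟩ := hE.exists_eq_units_smul 1 (z := 1) h1 (fun M => Commute.one_right _) isUnit_one
  obtain ⟨z, hz⟩ := IsAlgClosed.exists_pow_nat_eq ((d * c⁻¹ : Fˣ) : F) hm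
  refine ⟨z, ?_⟩
  rw [smul_pow, hz, hc, smul_smul, Units.val_mul, mul_assoc, Units.inv_mul, mul_one, ← hd]

/-- Such a `u h` commutes with a spanning set, hence is a scalar and has degree `1`; a nonzero
element has only one degree. -/
theorem bicharacter_nondegenerate [Algebra.IsCentral F A] (hE : IsElementaryTwisted 𝓐 t H E u)
    (h𝓐 : IsAlgGrading 𝓐) (h1 : (1 : A) ∈ 𝓐 1) (h : H) (hcomm : ∀ h', Commute (u h) (u h')) :
    h = 1 := by
  classical
  have hcen : u h ∈ Subalgebra.center F A := by
    rw [Subalgebra.mem_center_iff]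
    intro z
    have hz : z ∈ Submodule.span F {z | ∃ i j h, z = E (Matrix.single i j 1) * u h} :=
      hE.span_eq_top ▸ Submodule.mem_top
    induction hz using Submodule.span_induction with
    | mem z hz =>
      obtain ⟨i, j, h', rfl⟩ := hz
      exact ((hE.commute _ h).mul_left (hcomm h').symm).eq
    | zero => simp
    | add x y _ _ hx hy => rw [add_mul, mul_add, hx, hy]
    | smul c x _ hx => rw [smul_mul_assoc, mul_smul_comm, hx]
  obtain ⟨c, hc⟩ := Algebra.mem_bot.1 (Algebra.IsCentral.out hcen)
  have hu1 : u h ∈ 𝓐 1 := by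
    rw [← hc, Algebra.algebraMap_eq_smul_one]
    exact Submodule.smul_mem _ _ h1
  by_contra hne
  have hdis := h𝓐.isInternal.submodule_iSupIndep.pairwiseDisjoint
    (show (h : G) ≠ 1 from fun h' => hne (Subtype.ext h'))
  exact (hE.isUnit h).ne_zero (Submodule.disjoint_def.1 hdis _ (hE.mem h) hu1)

/-- Multiplying by diagonal matrix units on both sides isolates one pair of indices; the remaining
terms are nonzero of distinct degrees. -/
theorem linearIndependent (hE : IsElementaryTwisted 𝓐 t H E u) [Finite G]
    (h𝓐 : IsAlgGrading 𝓐) :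
    LinearIndependent F fun x : (Fin s × Fin s) × H => E (Matrix.single x.1.1 x.1.2 1) * u x.2 := by
  classical
  have := Fintype.ofFinite H
  have : Nonempty (Fin s) := ⟨⟨0, hE.pos⟩⟩
  rw [Fintype.linearIndependent_iff]
  rintro c hc ⟨⟨a, b⟩, h⟩
  have hsum : ∑ h, c ((a, b), h) • (E (Matrix.single a b 1) * u h) = 0 := by
    have h2 := congrArg (fun z => E (Matrix.single a a 1) * z * E (Matrix.single b b 1)) hc
    simp only [mul_zero, zero_mul] at h2
    rw [Fintype.sum_prod_type, Finset.mul_sum, Finset.sum_mul, Finset.sum_eq_single (a, b)] at h2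
    · rw [← h2, Finset.mul_sum, Finset.sum_mul]
      refine Finset.sum_congr rfl fun h _ => ?_
      rw [mul_smul_comm, smul_mul_assoc, ← mul_assoc, ← map_mul, mul_assoc,
        ← (hE.commute _ h).eq, ← mul_assoc, ← map_mul]
      simp
    · rintro ⟨i, j⟩ - hij
      rw [Finset.mul_sum, Finset.sum_mul]
      refine Finset.sum_eq_zero fun h _ => ?_
      rw [mul_smul_comm, smul_mul_assoc, ← mul_assoc, ← map_mul, mul_assoc,
        ← (hE.commute _ h).eq, ← mul_assoc, ← map_mul]
      have : Matrix.single a a (1 : F) * Matrix.single i j 1 * Matrix.single b b 1 = 0 := by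
        by_cases hia : a = i
        · have hjb : j ≠ b := fun hjb => hij (by rw [hia, hjb])
          rw [mul_assoc, Matrix.single_mul_single_of_ne _ _ _ _ hjb, mul_zero]
        · rw [Matrix.single_mul_single_of_ne _ _ _ _ hia, zero_mul]
      rw [this, map_zero, zero_mul, smul_zero]
    · simp
  have hli : LinearIndependent F fun h => E (Matrix.single a b 1) * u h := by
    refine iSupIndep.linearIndependent (fun h : H => 𝓐 ((t a)⁻¹ * t b * h))
      (h𝓐.isInternal.submodule_iSupIndep.comp
        (f := fun h : H => (t a)⁻¹ * t b * (h : G)) fun h h' hh => ?_)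
      (fun h => h𝓐.mul_mem _ _ _ _ (hE.single_mem a b) (hE.mem h)) fun h h0 => ?_
    · exact Subtype.ext (mul_left_cancel hh)
    · have h3 : E (Matrix.single a b 1) = 0 := (hE.isUnit h).mul_left_eq_zero.1 h0
      have h4 := (map_eq_zero_iff E E.toRingHom.injective).1 h3
      have h5 := congrFun (congrFun h4 a) b
      simp at h5
  exact Fintype.linearIndependent_iff.1 hli _ hsum h

end IsElementaryTwisted

/-! ### Maps out of `ℤ/m × ℤ/m` -/

section Pairs

variable {G : Type*} [CommGroup G]

theorem exists_hom_of_pow_eq_one {m : ℕ} {a b : G} (ha : a ^ m = 1) (hb : b ^ m = 1) :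
    ∃ ψ : Multiplicative (ZMod m × ZMod m) →* G,
      ∀ i j : ℕ, ψ (Multiplicative.ofAdd ((i : ZMod m), (j : ZMod m))) = a ^ i * b ^ j := by
  have hz : ∀ {x : G}, x ^ m = 1 → zmultiplesHom (Additive G) (Additive.ofMul x) (m : ℤ) = 0 := by
    intro x hx
    rw [zmultiplesHom_apply, natCast_zsmul, ← ofMul_pow, hx, ofMul_one]
  have hl : ∀ {x : G} (hx : x ^ m = 1) (i : ℕ),
      ZMod.lift m ⟨_, hz hx⟩ (i : ZMod m) = Additive.ofMul (x ^ i) := by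
    intro x hx i
    have h := ZMod.lift_coe m ⟨_, hz hx⟩ (i : ℤ)
    rwa [Int.cast_natCast, zmultiplesHom_apply, natCast_zsmul, ← ofMul_pow] at h
  refine ⟨AddMonoidHom.toMultiplicativeLeft
    ((ZMod.lift m ⟨_, hz ha⟩).coprod (ZMod.lift m ⟨_, hz hb⟩)), fun i j => ?_⟩
  change Additive.toMul (AddMonoidHom.coprod _ _ _) = _
  exact congrArg₂ (fun x y => Additive.toMul (x + y)) (hl ha i) (hl hb j)

theorem exists_natCast_eq {m : ℕ} (hm : 0 < m) (x : Multiplicative (ZMod m × ZMod m)) :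
    ∃ i j : ℕ, x = Multiplicative.ofAdd ((i : ZMod m), (j : ZMod m)) := by
  have : NeZero m := ⟨hm.ne'⟩
  refine ⟨(Multiplicative.toAdd x).1.val, (Multiplicative.toAdd x).2.val, ?_⟩
  rw [ZMod.natCast_zmod_val, ZMod.natCast_zmod_val]
  rfl

end Pairs

/-! ### Finite tensor products of algebras -/

section PiTensor

variable {F : Type*} [Field F] {A : Type*} [Ring A] [Algebra F A]

theorem prod_ofFn_mul {k : ℕ} (x y : Fin k → A) (h : ∀ i j, i ≠ j → Commute (x i) (y j)) :
    (List.ofFn fun i => x i * y i).prod = (List.ofFn x).prod * (List.ofFn y).prod := by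
  induction k with
  | zero => simp
  | succ k ih =>
    have hc : Commute (y 0) (List.ofFn fun i : Fin k => x i.succ).prod := by
      refine Commute.list_prod_right _ _ fun z hz => ?_
      obtain ⟨i, rfl⟩ := (List.mem_ofFn' _ _).1 hz
      exact (h _ _ (Fin.succ_ne_zero i)).symm
    simp only [List.ofFn_succ, List.prod_cons]
    rw [ih _ _ fun i j hij => h _ _ fun h => hij (Fin.succ_injective _ h), mul_assoc, mul_assoc,
      ← mul_assoc (y 0), hc.eq, mul_assoc]

/-- Multiplicativity needs the images of different factors to commute, so that a product of ordered
products can be regrouped factor by factor. -/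
theorem exists_piTensorProduct_algHom {k : ℕ} {B : Fin k → Type*} [∀ i, Ring (B i)]
    [∀ i, Algebra F (B i)] (f : ∀ i, B i →ₐ[F] A)
    (hf : ∀ i j, i ≠ j → ∀ x y, Commute (f i x) (f j y)) :
    ∃ Ψ : PiTensorProduct F B →ₐ[F] A,
      ∀ b, Ψ (PiTensorProduct.tprod F b) = (List.ofFn fun i => f i (b i)).prod := by
  let φ : MultilinearMap F B A :=
    (MultilinearMap.mkPiAlgebraFin F k A).compLinearMap fun i => (f i).toLinearMap
  have hφ : ∀ b, φ b = (List.ofFn fun i => f i (b i)).prod := fun b => by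
    simp [φ]
  refine ⟨PiTensorProduct.liftAlgHom φ ?_ fun x y => ?_, fun b => ?_⟩
  · rw [hφ]
    simp
  · rw [hφ, hφ, hφ, ← prod_ofFn_mul _ _ fun i j hij => hf i j hij _ _]
    simp
  · rw [PiTensorProduct.liftAlgHom_apply, PiTensorProduct.lift.tprod, hφ]

theorem IsAlgGrading.prod_ofFn_mem {G : Type*} [CommGroup G] {𝓐 : G → Submodule F A}
    (h𝓐 : IsAlgGrading 𝓐) (h1 : (1 : A) ∈ 𝓐 1) {k : ℕ} {x : Fin k → A} {d : Fin k → G}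
    (hx : ∀ i, x i ∈ 𝓐 (d i)) : (List.ofFn x).prod ∈ 𝓐 (∏ i, d i) := by
  induction k with
  | zero => simpa using h1
  | succ k ih =>
    rw [List.ofFn_succ, List.prod_cons, Fin.prod_univ_succ]
    exact h𝓐.mul_mem _ _ _ _ (hx 0) (ih fun i => hx i.succ)

theorem finrank_piTensorProduct_matrix {k : ℕ} (m : Fin k → ℕ) :
    Module.finrank F (PiTensorProduct F fun i : Fin k => Matrix (Fin (m i)) (Fin (m i)) F) =
      ∏ i, m i * m i := by
  rw [Module.finrank_eq_card_basis
    (Basis.piTensorProduct fun i => Matrix.stdBasis F (Fin (m i)) (Fin (m i)))]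
  simp

end PiTensor

/-! ### Supports of the two kinds of grading -/

section Supports

variable {F : Type*} [Field F] {G : Type*} [CommGroup G]

theorem support_epsilonGrading {m : ℕ} (hm : 0 < m) {ε : F} (hε : IsPrimitiveRoot ε m)
    {H : Subgroup G} (θ : Multiplicative (ZMod m × ZMod m) ≃* H) :
    support (epsilonGrading ε θ) = (H : Set G) := by
  have : Nonempty (Fin m) := ⟨⟨0, hm⟩⟩
  ext g
  constructor
  · intro hg
    by_contra hgH
    refine hg ?_
    rw [epsilonGrading, Submodule.span_eq_bot]
    rintro _ ⟨i, j, hij, -⟩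
    exact absurd (hij ▸ (θ _).2) hgH
  · intro hg hbot
    obtain ⟨i, j, hij⟩ := exists_natCast_eq hm (θ.symm ⟨g, hg⟩)
    have hmem : matXa m ε ^ i * matXb F m ^ j ∈ epsilonGrading ε θ g :=
      Submodule.subset_span ⟨i, j, by rw [← hij, MulEquiv.apply_symm_apply], rfl⟩
    rw [hbot, Submodule.mem_bot] at hmem
    exact (((isUnit_matXa hm hε).pow i).mul ((isUnit_matXb hm).pow j)).ne_zero hmem

theorem support_elementaryGrading_inter {s : ℕ} (hs : 0 < s) {t : Fin s → G} {H : Subgroup G}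
    (ht : ∀ i j, (t i)⁻¹ * t j ∈ H → t i = t j) :
    support (elementaryGrading F t) ∩ (H : Set G) = {1} := by
  ext g
  rw [Set.mem_singleton_iff]
  constructor
  · rintro ⟨hg, hgH⟩
    by_contra hg1
    refine hg ?_
    rw [elementaryGrading, Submodule.span_eq_bot]
    rintro _ ⟨i, j, hij, -⟩
    refine absurd ?_ hg1
    rw [← hij, ht i j (hij ▸ hgH), inv_mul_cancel]
  · rintro rfl
    refine ⟨fun hbot => ?_, H.one_mem⟩
    have hmem : Matrix.single ⟨0, hs⟩ ⟨0, hs⟩ (1 : F) ∈ elementaryGrading F t 1 :=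
      Submodule.subset_span ⟨_, _, inv_mul_cancel _, rfl⟩
    rw [hbot, Submodule.mem_bot] at hmem
    simpa using congrFun (congrFun hmem ⟨0, hs⟩) ⟨0, hs⟩

end Supports

end GroupGrading

/-! ### Assembly of the graded tensor product -/

namespace GroupGrading

/-- A graded matrix algebra which is an elementary grading times a twisted group
algebra is a tensor product of an elementary grading and of `ε`-gradings. -/
theorem IsElementaryTwisted.hasTensorForm {F : Type*} [Field F] [IsAlgClosed F] [CharZero F]
    {G : Type*} [CommGroup G] [Finite G] {n : ℕ} (hn : 0 < n)
    {𝓡 : G → Submodule F (Matrix (Fin n) (Fin n) F)} (h𝓡 : IsAlgGrading 𝓡)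
    (h1 : (1 : Matrix (Fin n) (Fin n) F) ∈ 𝓡 1) {s : ℕ} {t : Fin s → G} {H : Subgroup G}
    {E : Matrix (Fin s) (Fin s) F →ₐ[F] Matrix (Fin n) (Fin n) F}
    {u : H → Matrix (Fin n) (Fin n) F} (hE : IsElementaryTwisted 𝓡 t H E u) :
    HasTensorForm 𝓡 := by
  classical
  have : Nonempty (Fin n) := ⟨⟨0, hn⟩⟩
  obtain ⟨β, halt, hβ⟩ := exists_commutation_bicharacter hE.isUnit (hE.exists_mul_eq h𝓡)
  have hcommu : ∀ h h', β h h' = 1 → Commute (u h) (u h') := fun h h' hh => by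
    have := hβ h h'
    rwa [hh, Units.val_one, one_smul] at this
  obtain ⟨k, m, a, b, hm, ham, hbm, hroot, horth, hgen⟩ := exists_symplectic_generators β halt
    fun h hh => hE.bicharacter_nondegenerate h𝓡 h1 h fun h' => hcommu h h' (hh h')
  have hε : ∀ i, IsPrimitiveRoot (β (a i) (b i) : F) (m i) := fun i =>
    IsPrimitiveRoot.coe_units_iff.2 (hroot i)
  -- generators of the twisted group algebra satisfying the clock and shift relations
  choose c hc using fun i => hE.exists_smul_pow_eq_one h𝓡 h1 (hm i) (a i) (ham i)
  choose d hd using fun i => hE.exists_smul_pow_eq_one h𝓡 h1 (hm i) (b i) (hbm i)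
  choose f hfa hfb hfc using fun i => exists_algHom_of_clock_shift (hm i) (hε i) (hc i) (hd i)
    (by rw [smul_mul_smul_comm, smul_mul_smul_comm, hβ, smul_comm, mul_comm (c i)])
  have hff : ∀ i j, i ≠ j → ∀ x y, Commute (f i x) (f j y) := by
    intro i j hij x y
    have hax : ∀ h, Commute (u (a i)) (u h) → Commute (u (b i)) (u h) → ∀ z : F,
        Commute (z • u h) (f i x) := fun h h2 h3 z =>
      (hfc i _ ((h2.smul_left _).smul_right _) ((h3.smul_left _).smul_right _) x).symm
    refine (hfc j _ (hax _ (hcommu _ _ (horth i j hij).1) ?_ _) (hax _ (hcommu _ _ ?_) ?_ _) y).symm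
    · exact (hcommu _ _ (horth j i hij.symm).2.1).symm
    · exact (horth i j hij).2.1
    · exact hcommu _ _ (horth i j hij).2.2
  have hEf : ∀ M i N, Commute (E M) (f i N) := fun M i N =>
    (hfc i _ ((hE.commute M _).symm.smul_left _) ((hE.commute M _).symm.smul_left _) N).symm
  obtain ⟨Ψ, hΨ⟩ := exists_piTensorProduct_algHom f hff
  have hEΨ : ∀ M y, Commute (E M) (Ψ y) := by
    intro M y
    induction y using PiTensorProduct.induction_on with
    | smul_tprod r x =>
      rw [map_smul, hΨ]
      refine (Commute.list_prod_right _ _ fun z hz => ?_).smul_right _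
      obtain ⟨i, rfl⟩ := (List.mem_ofFn' _ _).1 hz
      exact hEf M i _
    | add x y hx hy =>
      rw [map_add]
      exact hx.add_right hy
  let Φ := Algebra.TensorProduct.lift E Ψ hEΨ
  have hΦ : ∀ x y, Φ (x ⊗ₜ[F] y) = E x * Ψ y := fun x y =>
    Algebra.TensorProduct.lift_tmul _ _ _ _ _
  -- the subgroups generated by the hyperbolic pairs
  have hamG : ∀ i, (a i : G) ^ m i = 1 := fun i => by
    rw [← Subgroup.coe_pow, ham, Subgroup.coe_one]
  have hbmG : ∀ i, (b i : G) ^ m i = 1 := fun i => by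
    rw [← Subgroup.coe_pow, hbm, Subgroup.coe_one]
  choose ψ hψ using fun i => exists_hom_of_pow_eq_one (hamG i) (hbmG i)
  have hψH : ∀ i x, ψ i x ∈ H := by
    intro i x
    obtain ⟨p, q, rfl⟩ := exists_natCast_eq (hm i) x
    rw [hψ]
    exact H.mul_mem (H.pow_mem (a i).2 _) (H.pow_mem (b i).2 _)
  have hψ1 : ∀ x : ∀ i, Multiplicative (ZMod (m i) × ZMod (m i)), ∏ i, ψ i (x i) = 1 →
      ∀ i, x i = 1 := by
    intro x hx i
    choose p q hpq using fun i => exists_natCast_eq (hm i) (x i)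
    have hprod : ∏ i, a i ^ p i * b i ^ q i = 1 := by
      refine Subtype.ext ?_
      rw [Subgroup.val_finsetProd, Subgroup.coe_one, ← hx]
      exact Finset.prod_congr rfl fun i _ => by rw [hpq i, hψ]; rfl
    obtain ⟨hp, hq⟩ := dvd_of_prod_pow_mul_pow_eq_one β halt hroot horth hprod i
    rw [hpq i, (ZMod.natCast_eq_zero_iff _ _).2 hp, (ZMod.natCast_eq_zero_iff _ _).2 hq]
    rfl
  have hψprod : Function.Injective
      fun x : ∀ i, Multiplicative (ZMod (m i) × ZMod (m i)) => ∏ i, ψ i (x i) := by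
    intro x y hxy
    funext i
    refine div_eq_one.1 (hψ1 (fun i => x i / y i) ?_ i)
    simp only [map_div, Finset.prod_div_distrib]
    exact div_eq_one.2 hxy
  have hψinj : ∀ i, Function.Injective (ψ i) := by
    intro i
    rw [injective_iff_map_eq_one]
    intro x hx
    have := hψ1 (Pi.mulSingle i x) (Finset.prod_eq_one fun j _ => by
      by_cases hj : j = i
      · subst hj; rw [Pi.mulSingle_eq_same, hx]
      · rw [Pi.mulSingle_eq_of_ne hj, map_one]) i
    rwa [Pi.mulSingle_eq_same] at this
  let θ := fun i => MonoidHom.ofInjective (hψinj i)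
  have hθ : ∀ i x, ((θ i x : (ψ i).range) : G) = ψ i x := fun i x =>
    MonoidHom.ofInjective_apply (hψinj i)
  -- the homomorphism from the tensor product is graded
  have hEmem : ∀ g, ∀ x ∈ elementaryGrading F t g, E x ∈ 𝓡 g := by
    intro g
    change elementaryGrading F t g ≤ (𝓡 g).comap E.toLinearMap
    refine Submodule.span_le.2 ?_
    rintro _ ⟨i, j, rfl, rfl⟩
    exact hE.single_mem i j
  have hfmem : ∀ i g, ∀ x ∈ epsilonGrading (β (a i) (b i) : F) (θ i) g, f i x ∈ 𝓡 g := by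
    intro i g
    change epsilonGrading _ (θ i) g ≤ (𝓡 g).comap (f i).toLinearMap
    refine Submodule.span_le.2 ?_
    rintro _ ⟨p, q, rfl, rfl⟩
    rw [SetLike.mem_coe, Submodule.mem_comap, AlgHom.toLinearMap_apply, map_mul, map_pow, map_pow,
      hfa, hfb, hθ, hψ]
    exact h𝓡.mul_mem _ _ _ _ (h𝓡.pow_mem h1 (Submodule.smul_mem _ _ (hE.mem _)) _)
      (h𝓡.pow_mem h1 (Submodule.smul_mem _ _ (hE.mem _)) _)
  let 𝓣 := tensorGrading (elementaryGrading F t)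
    (fun i => epsilonGrading (β (a i) (b i) : F) (θ i))
  have hle : ∀ g, (𝓣 g).map Φ.toLinearMap ≤ 𝓡 g := by
    intro g
    rw [Submodule.map_le_iff_le_comap]
    refine Submodule.span_le.2 ?_
    rintro _ ⟨d₀, d, x, y, hx, hy, rfl, rfl⟩
    rw [SetLike.mem_coe, Submodule.mem_comap, AlgHom.toLinearMap_apply, hΦ, hΨ]
    exact h𝓡.mul_mem _ _ _ _ (hEmem _ _ hx) (h𝓡.prod_ofFn_mem h1 fun i => hfmem i _ _ (hy i))
  have htop : ⨆ g, (𝓣 g).map Φ.toLinearMap = ⊤ := by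
    rw [eq_top_iff, ← hE.span_eq_top]
    refine Submodule.span_le.2 ?_
    rintro _ ⟨i, j, h, rfl⟩
    obtain ⟨p, q, rfl⟩ := hgen h
    let y := PiTensorProduct.tprod F fun i =>
      matXa (m i) (β (a i) (b i) : F) ^ p i * matXb F (m i) ^ q i
    have hyu : IsUnit (Ψ y) := by
      refine IsUnit.map Ψ (IsUnit.map (PiTensorProduct.tprodMonoidHom F) (Pi.isUnit_iff.2 ?_))
      exact fun i => ((isUnit_matXa (hm i) (hε i)).pow _).mul ((isUnit_matXb (hm i)).pow _)
    have hpq : ((∏ i, a i ^ p i * b i ^ q i : H) : G) =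
        ∏ i, (θ i (Multiplicative.ofAdd ((p i : ZMod (m i)), (q i : ZMod (m i)))) : G) := by
      rw [Subgroup.val_finsetProd]
      exact Finset.prod_congr rfl fun i _ => by rw [hθ, hψ]; rfl
    have hyε : ∀ i, matXa (m i) (β (a i) (b i) : F) ^ p i * matXb F (m i) ^ q i ∈
        epsilonGrading (β (a i) (b i) : F) (θ i)
          (θ i (Multiplicative.ofAdd ((p i : ZMod (m i)), (q i : ZMod (m i)))) : G) :=
      fun i => Submodule.subset_span ⟨p i, q i, rfl, rfl⟩
    have hy : Ψ y ∈ 𝓡 (∏ i, a i ^ p i * b i ^ q i : H) := by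
      rw [hpq, hΨ]
      exact h𝓡.prod_ofFn_mem h1 fun i => hfmem i _ _ (hyε i)
    -- `Ψ y` is an invertible element of degree `h` centralizing the matrix units, hence
    -- proportional to `u h`; so the image contains a spanning set.
    obtain ⟨z, hz⟩ := hE.exists_eq_units_smul _ hy (fun M => hEΨ M y) hyu
    have hzinv : u (∏ i, a i ^ p i * b i ^ q i) = ((z⁻¹ : Fˣ) : F) • Ψ y := by
      rw [hz, smul_smul, Units.inv_mul, one_smul]
    rw [hzinv, mul_smul_comm, ← hΦ]
    refine Submodule.smul_mem _ _ (Submodule.mem_iSup_of_mem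
      ((t i)⁻¹ * t j * (∏ i, a i ^ p i * b i ^ q i : H))
      (Submodule.mem_map.2 ⟨Matrix.single i j 1 ⊗ₜ[F] y, ?_, rfl⟩))
    exact Submodule.subset_span ⟨_, _, _, _, Submodule.subset_span ⟨i, j, rfl, rfl⟩, hyε,
      by rw [hpq], rfl⟩
  -- Images of the components lie in the right degrees and together span, so the inclusions are
  -- equalities.
  have heq := eq_of_le_of_iSup_eq_top hle h𝓡.isInternal.submodule_iSupIndep htop
  have hsurj : Function.Surjective Φ.toLinearMap := by
    rw [← LinearMap.range_eq_top, eq_top_iff, ← htop]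
    exact iSup_le fun g => LinearMap.map_le_range
  have hcard : ∏ i, m i * m i ≤ Nat.card H := by
    have h2 := Nat.card_le_card_of_injective
      (fun x : ∀ i, Multiplicative (ZMod (m i) × ZMod (m i)) =>
        (⟨∏ i, ψ i (x i), H.prod_mem fun i _ => hψH i _⟩ : H))
      fun x y hxy => hψprod (congrArg Subtype.val hxy)
    rw [Nat.card_pi] at h2
    refine le_trans (le_of_eq (Finset.prod_congr rfl fun i _ => ?_)) h2
    rw [Nat.card_congr Multiplicative.toAdd, Nat.card_prod, Nat.card_zmod]
  -- Surjectivity gives one inequality. For the other, the tensor product has dimension `s² ∏ mᵢ²`,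
  -- at most `s² |H|`, and that many elements of `R` are linearly independent.
  have hdim : Module.finrank F (Matrix (Fin s) (Fin s) F ⊗[F]
      (PiTensorProduct F fun i : Fin k => Matrix (Fin (m i)) (Fin (m i)) F)) =
      Module.finrank F (Matrix (Fin n) (Fin n) F) := by
    refine le_antisymm ?_ (LinearMap.finrank_le_finrank_of_surjective hsurj)
    have := Fintype.ofFinite H
    refine le_trans ?_ (hE.linearIndependent h𝓡).fintype_card_le_finrank
    rw [Module.finrank_tensorProduct, finrank_piTensorProduct_matrix, Module.finrank_matrix,
      Module.finrank_self, mul_one, Fintype.card_prod, Fintype.card_prod, ← Nat.card_eq_fintype_card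
      (α := H)]
    exact Nat.mul_le_mul_left _ hcard
  have hinj := (LinearMap.injective_iff_surjective_of_finrank_eq_finrank hdim).2 hsurj
  let e := AlgEquiv.ofBijective Φ ⟨hinj, hsurj⟩
  refine ⟨s, k, m, t, fun i => (β (a i) (b i) : F), fun i => (ψ i).range, θ, hE.pos, hm, hε,
    fun i => support_epsilonGrading (hm i) (hε i) (θ i), ?_,
    support_elementaryGrading_inter hE.pos fun i j hij => hE.eq_of_mem i j ?_, e.symm, fun g => ?_⟩
  · intro x y hxy
    have hx : ∀ i, ∃ z, θ i z = x i := fun i => (θ i).surjective _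
    have hy : ∀ i, ∃ z, θ i z = y i := fun i => (θ i).surjective _
    choose x' hx' using hx
    choose y' hy' using hy
    have : x' = y' := hψprod (by
      simp only [← hx', ← hy', hθ] at hxy
      exact hxy)
    funext i
    rw [← hx', ← hy', this]
  · refine (iSup_le fun i => ?_ : (⨆ i, (ψ i).range) ≤ H) hij
    rintro _ ⟨x, rfl⟩
    exact hψH i x
  · rw [← heq g, ← Submodule.map_comp]
    have : e.symm.toLinearMap ∘ₗ Φ.toLinearMap = LinearMap.id :=
      LinearMap.ext fun x => e.symm_apply_apply x
    rw [this, Submodule.map_id]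

end GroupGrading

theorem theorem3 {F : Type*} [Field F] [IsAlgClosed F] [CharZero F]
    {G : Type*} [CommGroup G] [Finite G] {n : ℕ} (hn : 0 < n)
    (𝓛 : G → Submodule F (LieAlgebra.SpecialLinear.sl (Fin n) F))
    (h𝓛 : GroupGrading.IsLieGrading 𝓛) (hinner : GroupGrading.IsInnerGrading 𝓛 h𝓛) :
    ∃ 𝓡 : G → Submodule F (Matrix (Fin n) (Fin n) F),
      GroupGrading.IsAlgGrading 𝓡 ∧
      GroupGrading.HasTensorForm 𝓡 ∧
      ∀ (g : G) (X : LieAlgebra.SpecialLinear.sl (Fin n) F),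
        X ∈ 𝓛 g ↔ (X : Matrix (Fin n) (Fin n) F) ∈ 𝓡 g := by
  choose T hT using hinner
  have h𝓡 := GroupGrading.isAlgGrading_conjEigenspace hn h𝓛 hT
  obtain ⟨s, t, H, E, u, hE⟩ := GroupGrading.exists_elementary_mul_twistedGroupAlgebra hn h𝓡
    GroupGrading.one_mem_conjEigenspace
    fun g hg X hX => GroupGrading.trace_eq_zero_of_mem_conjEigenspace hg hX
  exact ⟨_, h𝓡, hE.hasTensorForm hn h𝓡 GroupGrading.one_mem_conjEigenspace,
    GroupGrading.mem_iff_mem_conjEigenspace h𝓛 hT⟩
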